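/- Let $\mathcal A$ be a $C^*$-algebra with multiplier algebra $M(\mathcal A)$, let $\varphi$ be a positive functional on $\mathcal A$, and let $\mathcal C$ be a separable abelian $C^*$-subalgebra of $\mathcal A$ contained in the centralizer $$\mathcal A^\varphi=\{y\in\mathcal A\mid \varphi(xy)=\varphi(yx)\ \ \forall x\in\mathcal A\}.$$ Identify $\mathcal C=C_0(S)$ for a locally compact metrizable space $S$, and let $\mu_\varphi$ be the finite Radon measure on $S$ with $\varphi(y)=\int_S y(s)\,d\mu_\varphi(s)$ for $y\in\mathcal C$. Let $\Phi\colon M(\mathcal A)\to L^\infty(S,\mu_\varphi)$ be the associated conditional expectation, that is, $\Phi(x)$ is the unique element of $L^\infty(S,\mu_\varphi)$ with $$\int_S z(s)\,\Phi(x)(s)\,d\mu_\varphi(s)=\varphi(zx)\qquad (z\in\mathcal C).$$ Integrals of fields $t\mapsto b_t\in M(\mathcal A)$ over a locally compact Hausdorff space $T$ with a Radon measure $\nu$ are understood in the weak* sense: $m=\int_T b_t\,d\nu(t)$ means that $m\in M(\mathcal A)$, that $t\mapsto\rho(b_t)$ is $\nu$-integrable, and that $\rho(m)=\int_T\rho(b_t)\,d\nu(t)$,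 for every $\rho\in\mathcal A^*$, canonically extended to $M(\mathcal A)$. A field $t\mapsto x_t\in\mathcal A$ is weak* measurable if $t\mapsto\rho(x_t)$ is $\nu$-measurable for every $\rho\in\mathcal A^*$. A unital column field is a continuous field $t\mapsto a_t\in M(\mathcal A)$ with $\int_T a_t^*a_t\,d\nu(t)=1$; for continuity it is enough that $t\mapsto a_td$ is norm continuous for each $d\in\mathcal A$. Let $f\colon\underline I\to\mathbf R$ be a continuous convex function of $n$ variables defined on a cube $\underline I=I_1\times\cdots\times I_n$, where each $I_i$ is an interval, let $t\mapsto a_t\in M(\mathcal A)$ be a unital column field on $T$, and let $t\mapsto\underline x_t=(x_{1t},\dots,x_{nt})$ be a bounded weak* measurable field on $T$ of abelian (i.e. mutually commuting) $n$-tuples of self-adjoint elements of $\mathcal A$ in the domain of $f$, that is, with $\sigma(x_{it})\subseteq I_i$. The spectrum and the element $f(\underline x_t)$ are taken in $M(\mathcal A)$. Suppose that the integrals $$y_i=\int_T a_t^*x_{it}a_t\,d\nu(t)\quad(i=1,\dots,n)\qquad\text{and}\qquad \int_T a_t^*f(\underline x_t)a_t\,d\nu(t)$$ exist in $M(\mathcal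 A)$. Then, almost everywhere with respect to $\mu_\varphi$, the $n$-tuple $(\Phi(y_1),\dots,\Phi(y_n))$ is real with values in $\underline I$, and $$f(\Phi(y_1),\dots,\Phi(y_n))\le\Phi\left(\int_T a_t^*f(\underline x_t)a_t\,d\nu(t)\right).$$ -/

import Mathlib

open MeasureTheory Filter Topology
open scoped MultiplierAlgebra ZeroAtInfty ComplexOrder ENNReal CompactlySupported

set_option linter.unusedSectionVars false

/-! In the multiplier algebra `𝓜(ℂ, A)` (double centralizers), `m.fst a` is the product `m a` and
`m.snd a` is the product `a m`, both in `A`. -/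

section JointFunctionalCalculus

variable {B : Type*} [CStarAlgebra B] {n : ℕ}

/-- The unital `C*`-subalgebra of `B` generated by `x₁, …, xₙ`. -/
noncomputable def tupleAlgebra (x : Fin n → B) : StarSubalgebra ℂ B :=
  (StarAlgebra.adjoin ℂ (Set.range x)).topologicalClosure

theorem mem_tupleAlgebra (x : Fin n → B) (i : Fin n) : x i ∈ tupleAlgebra x :=
  StarSubalgebra.le_topologicalClosure _ (StarAlgebra.subset_adjoin ℂ _ ⟨i, rfl⟩)

/-- `w = f(x₁, …, xₙ)` in the sense of the Gelfand representation of the `C*`-algebra generated by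
the tuple: the Gelfand transform of `w` is `χ ↦ f (χ x₁, …, χ xₙ)`. For commuting self-adjoint
`xᵢ` the numbers `χ xᵢ` are real, so that taking real parts changes nothing. -/
def IsTupleCalculus (f : (Fin n → ℝ) → ℝ) (x : Fin n → B) (w : tupleAlgebra x) : Prop :=
  ∀ χ : WeakDual.characterSpace ℂ (tupleAlgebra x),
    χ w = (f fun i => (χ ⟨x i, mem_tupleAlgebra x i⟩).re : ℂ)

open Classical in
/-- The continuous functional calculus `f(x) = f(x₁, …, xₙ)` of an abelian tuple of self-adjoint
elements. By `existsUnique_isTupleCalculus` the defining element exists and is unique as soon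
as the tuple is in the domain of the continuous function `f`. -/
noncomputable def tupleCalculus (f : (Fin n → ℝ) → ℝ) (x : Fin n → B) : B :=
  if h : ∃ w : tupleAlgebra x, IsTupleCalculus f x w then (h.choose : B) else 0

/-- Existence and uniqueness of `f(x)` for an abelian tuple of self-adjoint elements in the domain
of a continuous function. -/
theorem existsUnique_isTupleCalculus (I : Fin n → Set ℝ) (f : (Fin n → ℝ) → ℝ)
    (hf : ContinuousOn f (Set.univ.pi I)) (x : Fin n → B)
    (hcomm : ∀ i j, Commute (x i) (x j)) (hsa : ∀ i, IsSelfAdjoint (x i))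
    (hI : ∀ i, spectrum ℝ (x i) ⊆ I i) :
    ∃! w : tupleAlgebra x, IsTupleCalculus f x w := by
  have hc : ∀ a b : StarAlgebra.adjoin ℂ (Set.range x), a * b = b * a := by
    have : IsMulCommutative (StarAlgebra.adjoin ℂ (Set.range x)) :=
      StarAlgebra.isMulCommutative_adjoin ℂ
        (by rintro _ ⟨i, rfl⟩ _ ⟨j, rfl⟩; exact hcomm i j)
        (by rintro _ ⟨i, rfl⟩ _ ⟨j, rfl⟩; rw [(hsa j).star_eq]; exact hcomm i j)
    exact fun a b => this.is_comm.comm a b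
  have hc' : ∀ a b : tupleAlgebra x, a * b = b * a := by
    let _ : CommRing (tupleAlgebra x) := StarSubalgebra.commRingTopologicalClosure _ hc
    exact mul_comm
  have hcl : IsClosed (tupleAlgebra x : Set B) := StarSubalgebra.isClosed_topologicalClosure _
  let _ : CStarAlgebra (tupleAlgebra x) := StarSubalgebra.cstarAlgebra _ (h_closed := hcl)
  let _ : CommCStarAlgebra (tupleAlgebra x) := { mul_comm := hc' }
  have hre : ∀ (χ : WeakDual.characterSpace ℂ (tupleAlgebra x)) (i : Fin n),
      (χ ⟨x i, mem_tupleAlgebra x i⟩).re ∈ I i := by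
    intro χ i
    have h1 : χ ⟨x i, mem_tupleAlgebra x i⟩ ∈ spectrum ℂ (x i) := by
      have := AlgHom.apply_mem_spectrum χ (⟨x i, mem_tupleAlgebra x i⟩ : tupleAlgebra x)
      rwa [StarSubalgebra.spectrum_eq (hS := hcl)] at this
    apply hI i
    have h2 := (hsa i).mem_spectrum_eq_re h1
    rw [h2] at h1
    exact (spectrum.algebraMap_mem_iff ℂ (R := ℝ)).1 h1
  let F : C(WeakDual.characterSpace ℂ (tupleAlgebra x), ℂ) :=
    ⟨fun χ => (f fun i => (χ ⟨x i, mem_tupleAlgebra x i⟩).re : ℂ), by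
      refine Complex.continuous_ofReal.comp (hf.comp_continuous ?_ fun χ i _ => hre χ i)
      refine continuous_pi fun i => Complex.continuous_re.comp ?_
      exact map_continuous (WeakDual.gelfandTransform ℂ (tupleAlgebra x) ⟨x i, mem_tupleAlgebra x i⟩)⟩
  have key : ∀ w : tupleAlgebra x, IsTupleCalculus f x w ↔ gelfandStarTransform (tupleAlgebra x) w = F := by
    intro w
    rw [ContinuousMap.ext_iff]
    rfl
  obtain ⟨w, hw⟩ := (gelfandStarTransform (tupleAlgebra x)).surjective F
  exact ⟨w, (key w).2 hw, fun v hv =>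
    (gelfandStarTransform (tupleAlgebra x)).injective (((key v).1 hv).trans hw.symm)⟩

end JointFunctionalCalculus

section RieszMeasure
variable {A : Type*} [NonUnitalCStarAlgebra A] [PartialOrder A] [StarOrderedRing A]
variable {S : Type*} [TopologicalSpace S] [LocallyCompactSpace S] [TopologicalSpace.MetrizableSpace S]
  [MeasurableSpace S] [BorelSpace S]

/-- Composition `ψ ∘ g` for continuous `ψ` with `ψ 0 = 0`. -/
noncomputable def compZeroAtInfty (ψ : ℂ → ℂ) (hψ : Continuous ψ) (h0 : ψ 0 = 0) (g : C₀(S, ℂ)) : C₀(S, ℂ) where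
  toFun s := ψ (g s)
  continuous_toFun := hψ.comp (map_continuous g)
  zero_at_infty' := by
    have := (hψ.tendsto 0).comp g.zero_at_infty'
    rwa [h0] at this

/-- Real compactly supported functions as elements of `C₀(S, ℂ)`. -/
noncomputable def ofRealCompact : C_c(S, ℝ) →ₗ[ℝ] C₀(S, ℂ) where
  toFun g := ⟨⟨fun s => (g s : ℂ), Complex.continuous_ofReal.comp (map_continuous g)⟩,
    (g.hasCompactSupport.comp_left (g := fun r : ℝ => (r : ℂ)) (by simp)).is_zero_at_infty⟩
  map_add' f g := by ext s; simp
  map_smul' c g := by ext s; simp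

theorem exists_compact_approx (g : C₀(S, ℂ)) {ε : ℝ} (hε : 0 < ε) :
    ∃ u v : C_c(S, ℝ), ‖g - (ofRealCompact u + Complex.I • ofRealCompact v)‖ ≤ ε := by
  let ψ : ℂ → ℂ := fun z => ((max 0 (‖z‖ - ε) / max ‖z‖ ε : ℝ) : ℂ) * z
  have hmax : ∀ z : ℂ, max ‖z‖ ε ≠ 0 := fun z => (lt_max_of_lt_right hε).ne'
  have hψ : Continuous ψ := by
    refine (Complex.continuous_ofReal.comp (Continuous.div₀ (by fun_prop) (by fun_prop) hmax)).mul continuous_id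
  have hz : ∀ z : ℂ, ‖z‖ ≤ ε → ψ z = 0 := by
    intro z h
    simp [ψ, max_eq_left (sub_nonpos.2 h)]
  have hcs : HasCompactSupport (fun s => ψ (g s)) := by
    have h1 : ∀ᶠ s in cocompact S, ‖g s‖ < ε := by
      have := g.zero_at_infty'.norm
      rw [norm_zero] at this
      exact this.eventually (gt_mem_nhds hε)
    obtain ⟨K, hK, hKs⟩ := mem_cocompact.1 h1
    refine HasCompactSupport.intro hK fun s hs => hz _ (hKs hs).le
  have hc : Continuous (fun s => ψ (g s)) := hψ.comp (map_continuous g)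
  refine ⟨⟨⟨fun s => (ψ (g s)).re, Complex.continuous_re.comp hc⟩, hcs.comp_left (g := Complex.re) rfl⟩,
    ⟨⟨fun s => (ψ (g s)).im, Complex.continuous_im.comp hc⟩, hcs.comp_left (g := Complex.im) rfl⟩, ?_⟩
  rw [← ZeroAtInftyContinuousMap.norm_toBCF_eq_norm, BoundedContinuousFunction.norm_le hε.le]
  intro s
  have : (g - (ofRealCompact ⟨⟨fun s => (ψ (g s)).re, Complex.continuous_re.comp hc⟩, hcs.comp_left (g := Complex.re) rfl⟩ + Complex.I • ofRealCompact ⟨⟨fun s => (ψ (g s)).im, Complex.continuous_im.comp hc⟩, hcs.comp_left (g := Complex.im) rfl⟩)).toBCF s = g s - ψ (g s) := by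
    conv_rhs => rw [← Complex.re_add_im (ψ (g s)), mul_comm]
    rfl
  rw [this]
  generalize g s = z
  rcases le_total ‖z‖ ε with h | h
  · rw [hz z h]; simpa using h
  · have hz0 : 0 < ‖z‖ := hε.trans_le h
    have : z - ψ z = ((ε / ‖z‖ : ℝ) : ℂ) * z := by
      simp only [ψ, max_eq_right (sub_nonneg.2 h), max_eq_left h]
      rw [sub_div, div_self hz0.ne']; push_cast; ring
    rw [this, norm_mul, Complex.norm_real, Real.norm_of_nonneg (by positivity)]
    field_simp; rfl

/-- Riesz representation of the positive functional `g ↦ φ (ι g)` on `C₀(S)` by a finite Radon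
measure. -/
theorem exists_representingMeasure (φ : A →ₚ[ℂ] ℂ) (ι : C₀(S, ℂ) →⋆ₙₐ[ℂ] A) :
    ∃ μ : Measure S, IsFiniteMeasure μ ∧ μ.Regular ∧ ∀ g : C₀(S, ℂ), ∫ s, g s ∂μ = φ (ι g) := by
  have hpos : ∀ u : C_c(S, ℝ), 0 ≤ u → 0 ≤ φ (ι (ofRealCompact u)) := by
    intro u hu
    let k : C₀(S, ℂ) := compZeroAtInfty (fun z => ((√z.re : ℝ) : ℂ)) (by fun_prop) (by simp)
      (ofRealCompact u)
    have hk : ofRealCompact u = star k * k := by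
      ext s
      have : 0 ≤ u s := hu s
      change (u s : ℂ) = star ((√(u s : ℂ).re : ℝ) : ℂ) * ((√(u s : ℂ).re : ℝ) : ℂ)
      rw [Complex.ofReal_re, Complex.star_def, Complex.conj_ofReal, ← Complex.ofReal_mul,
        Real.mul_self_sqrt this]
    rw [hk, map_mul, map_star]
    exact φ.map_nonneg (star_mul_self_nonneg _)
  let Λ : C_c(S, ℝ) →ₚ[ℝ] ℝ := PositiveLinearMap.mk₀
    { toFun := fun u => (φ (ι (ofRealCompact u))).re
      map_add' := by intro u v; simp
      map_smul' := by
        intro c u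
        rw [LinearMap.map_smul, ← Complex.coe_smul, map_smul, map_smul]
        simp }
    (fun u hu => (Complex.le_def.1 (hpos u hu)).1)
  have hΛ : ∀ u, ((Λ u : ℝ) : ℂ) = φ (ι (ofRealCompact u)) := by
    intro u
    have him : (φ (ι (ofRealCompact u))).im = 0 := by
      have h1 : IsSelfAdjoint (ι (ofRealCompact u)) := by
        have : star (ofRealCompact u) = ofRealCompact u := by
          ext s; exact Complex.conj_ofReal _
        rw [isSelfAdjoint_iff, ← map_star, this]
      have h2 : star (φ (ι (ofRealCompact u))) = φ (ι (ofRealCompact u)) := by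
        rw [← map_star, h1.star_eq]
      exact Complex.conj_eq_iff_im.1 h2
    exact Complex.ext rfl him.symm
  obtain ⟨c, hc⟩ := PositiveLinearMap.exists_norm_apply_le φ
  have hb : ∀ g : C₀(S, ℂ), ‖φ (ι g)‖ ≤ c * ‖g‖ := fun g =>
    (hc _).trans (mul_le_mul_of_nonneg_left (NonUnitalStarAlgHom.norm_apply_le ι g) c.2)
  let μ := RealRMK.rieszMeasure Λ
  have hfin : IsFiniteMeasure μ := by
    refine ⟨lt_of_le_of_lt ?_ (ENNReal.ofReal_lt_top (r := (c : ℝ)))⟩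
    rw [isOpen_univ.measure_eq_iSup_isCompact]
    refine iSup₂_le fun K _ => iSup_le fun hK => ?_
    obtain ⟨u, hu1, -, hu3, hu4⟩ :=
      exists_continuous_one_zero_of_isCompact hK isClosed_empty (Set.disjoint_empty K)
    refine (RealRMK.rieszMeasure_le_of_eq_one Λ (f := ⟨u, hu3⟩) (fun s => (hu4 s).1) hK
      (fun s hs => hu1 hs)).trans (ENNReal.ofReal_le_ofReal ?_)
    refine ((Complex.re_le_norm _).trans (hb _)).trans (mul_le_of_le_one_right c.2 ?_)
    rw [← ZeroAtInftyContinuousMap.norm_toBCF_eq_norm, BoundedContinuousFunction.norm_le zero_le_one]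
    intro s
    change ‖(u s : ℂ)‖ ≤ 1
    rw [Complex.norm_real, Real.norm_of_nonneg (hu4 s).1]
    exact (hu4 s).2
  refine ⟨μ, hfin, inferInstance, fun g => ?_⟩
  have hint : ∀ g : C₀(S, ℂ), Integrable (fun s => g s) μ := fun g => g.toBCF.integrable μ
  have hreal : ∀ u : C_c(S, ℝ), ∫ s, (ofRealCompact u) s ∂μ = φ (ι (ofRealCompact u)) := by
    intro u
    rw [← hΛ, ← RealRMK.integral_rieszMeasure Λ u]
    exact integral_ofReal
  have hbound : ∀ ε > 0, ‖∫ s, g s ∂μ - φ (ι g)‖ ≤ (μ.real Set.univ + c) * ε := by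
    intro ε hε
    obtain ⟨u, v, huv⟩ := exists_compact_approx g hε
    set h := ofRealCompact u + Complex.I • ofRealCompact v with hh
    have h1 : ∫ s, h s ∂μ = φ (ι h) := by
      have : ∀ s, h s = ofRealCompact u s + Complex.I * ofRealCompact v s := fun s => rfl
      simp_rw [this]
      rw [integral_add (hint _) ((hint _).const_mul _), integral_const_mul, hreal, hreal, hh]
      simp
    have h2 : ∫ s, g s ∂μ - φ (ι g) = ∫ s, (g - h) s ∂μ - φ (ι (g - h)) := by
      have : ∀ s, (g - h) s = g s - h s := fun s => rfl
      simp_rw [this]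
      rw [integral_sub (hint _) (hint _), h1, map_sub, map_sub]; ring
    rw [h2, add_mul]
    refine (norm_sub_le _ _).trans (add_le_add ?_ ((hb _).trans (by gcongr)))
    rw [mul_comm]
    refine norm_integral_le_of_norm_le_const (ae_of_all _ fun s => ?_)
    refine le_trans ?_ huv
    exact (g - h).toBCF.norm_coe_le_norm s
  have h0 : ‖∫ s, g s ∂μ - φ (ι g)‖ ≤ 0 := by
    refine ge_of_tendsto (x := 𝓝[>] (0 : ℝ)) (f := fun ε => (μ.real Set.univ + c) * ε) ?_ 
      (eventually_nhdsWithin_of_forall hbound)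
    refine Tendsto.mono_left ?_ nhdsWithin_le_nhds
    have : Continuous fun ε : ℝ => (μ.real Set.univ + c) * ε := by fun_prop
    simpa using this.tendsto 0
  exact sub_eq_zero.1 (norm_le_zero_iff.1 h0)


theorem multiplier_snd_mul (m : 𝓜(ℂ, A)) (a b : A) : m.snd (a * b) = a * m.snd b := by
  have h : ∀ y, (m.snd (a * b) - a * m.snd b) * y = 0 := by
    intro y
    rw [sub_mul, m.central, mul_assoc, mul_assoc, m.central, sub_self]
  exact sub_eq_zero.1 ((CStarRing.mul_star_self_eq_zero_iff _).1 (h _))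

theorem star_multiplier_fst_mul (m : 𝓜(ℂ, A)) (a b : A) :
    star (m.fst a) * b = star a * (star m).fst b := by
  rw [← (star m).central, DoubleCentralizer.star_snd, star_star]

theorem norm_apply_mul_le (φ : A →ₚ[ℂ] ℂ) (ι : C₀(S, ℂ) →⋆ₙₐ[ℂ] A)
    (hι : ∀ (g : C₀(S, ℂ)) (a : A), φ (a * ι g) = φ (ι g * a))
    (μ : Measure S) (hμ : ∀ g : C₀(S, ℂ), ∫ s, g s ∂μ = φ (ι g))
    (x : 𝓜(ℂ, A)) (g : C₀(S, ℂ)) :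
    ‖φ (x.snd (ι g))‖ ≤ ‖x‖ * ∫ s, ‖g s‖ ∂μ := by
  let h : C₀(S, ℂ) := compZeroAtInfty (fun z => ((√‖z‖ : ℝ) : ℂ)) (by fun_prop) (by simp) g
  let ψ : ℂ → ℂ := fun z => z / ((√‖z‖ : ℝ) : ℂ)
  have hψn : ∀ z, ‖ψ z‖ = √‖z‖ := by
    intro z
    simp only [ψ, norm_div, Complex.norm_real, Real.norm_of_nonneg (Real.sqrt_nonneg _)]
    exact Real.div_sqrt
  have hψ : Continuous ψ := by
    rw [continuous_iff_continuousAt]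
    intro z
    by_cases hz : z = 0
    · subst hz
      have h0 : ψ 0 = 0 := by simp [ψ]
      rw [ContinuousAt, h0, tendsto_zero_iff_norm_tendsto_zero]
      simp_rw [hψn]
      have : Continuous fun z : ℂ => √‖z‖ := by fun_prop
      simpa using this.tendsto 0
    · refine ContinuousAt.div continuousAt_id (by fun_prop) ?_
      simpa [Real.sqrt_eq_zero'] using hz
  let k : C₀(S, ℂ) := compZeroAtInfty ψ hψ (by simp [ψ]) g
  have hg : g = h * k := by
    ext s
    change g s = ((√‖g s‖ : ℝ) : ℂ) * (g s / ((√‖g s‖ : ℝ) : ℂ))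
    by_cases hz : g s = 0
    · simp [hz]
    · rw [mul_div_cancel₀]
      simpa [Real.sqrt_eq_zero'] using hz
  set J : ℝ := ∫ s, ‖g s‖ ∂μ with hJ
  have hJ0 : 0 ≤ J := integral_nonneg fun s => norm_nonneg _
  have hh : φ (star (ι h) * ι h) = (J : ℂ) := by
    rw [← map_star, ← map_mul, ← hμ, hJ, ← integral_complex_ofReal]
    refine integral_congr_ae (ae_of_all _ fun s => ?_)
    change star ((√‖g s‖ : ℝ) : ℂ) * ((√‖g s‖ : ℝ) : ℂ) = _
    rw [Complex.star_def, Complex.conj_ofReal, ← Complex.ofReal_mul,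
      Real.mul_self_sqrt (norm_nonneg _)]
  have hk : φ (ι k * star (ι k)) = (J : ℂ) := by
    rw [← map_star, ← map_mul, ← hμ, hJ, ← integral_complex_ofReal]
    refine integral_congr_ae (ae_of_all _ fun s => ?_)
    change ψ (g s) * star (ψ (g s)) = _
    rw [Complex.star_def, Complex.mul_conj, Complex.normSq_eq_norm_sq, hψn,
      Real.sq_sqrt (norm_nonneg _)]
  -- the functional is rewritten as an inner product
  have hx : φ (x.snd (ι g)) = φ (ι k * x.fst (ι h)) := by
    have h1 : x.snd (ι g) = ι h * x.snd (ι k) := by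
      rw [hg, map_mul, multiplier_snd_mul]
    rw [h1, ← hι, ← x.central]
  have hxx : φ (star (x.fst (ι h)) * x.fst (ι h)) ≤ ((‖x‖ ^ 2 * J : ℝ) : ℂ) := by
    let _ : PartialOrder 𝓜(ℂ, A) := CStarAlgebra.spectralOrder _
    have _ : StarOrderedRing 𝓜(ℂ, A) := CStarAlgebra.spectralOrderedRing _
    have h1 : star x * x ≤ algebraMap ℝ _ (‖x‖ ^ 2) := CStarAlgebra.star_mul_le_algebraMap_norm_sq
    obtain ⟨c, hc⟩ := CStarAlgebra.nonneg_iff_eq_star_mul_self.1 (sub_nonneg.2 h1)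
    have h2 : 0 ≤ φ (star (c.fst (ι h)) * c.fst (ι h)) := φ.map_nonneg (star_mul_self_nonneg _)
    have h3 : algebraMap ℝ 𝓜(ℂ, A) (‖x‖ ^ 2) = algebraMap ℂ 𝓜(ℂ, A) ((‖x‖ ^ 2 : ℝ) : ℂ) :=
      IsScalarTower.algebraMap_apply ℝ ℂ _ _
    have h4 : ∀ y : 𝓜(ℂ, A), star (y.fst (ι h)) * y.fst (ι h) = star (ι h) * (star y * y).fst (ι h) := by
      intro y
      rw [star_multiplier_fst_mul, DoubleCentralizer.mul_fst]; rfl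
    rw [h4, ← hc, h3, DoubleCentralizer.sub_fst, DoubleCentralizer.algebraMap_fst,
      Algebra.algebraMap_eq_smul_one, sub_apply, mul_sub, map_sub,
      smul_apply, one_apply_eq_self, mul_smul_comm, map_smul, hh,
      sub_nonneg] at h2
    rw [h4]
    simpa using h2
  have hcs : ‖φ (ι k * x.fst (ι h))‖ ≤
      √(φ (ι k * star (ι k))).re * √(φ (star (x.fst (ι h)) * x.fst (ι h))).re := by
    have := norm_inner_le_norm (𝕜 := ℂ) (φ.toPreGNS (star (ι k))) (φ.toPreGNS (x.fst (ι h)))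
    rw [PositiveLinearMap.preGNS_inner_def, PositiveLinearMap.preGNS_norm_def,
      PositiveLinearMap.preGNS_norm_def] at this
    simpa using this
  rw [hx]
  refine hcs.trans ?_
  rw [hk, Complex.ofReal_re]
  calc √J * √(φ (star (x.fst (ι h)) * x.fst (ι h))).re ≤ √J * √(‖x‖ ^ 2 * J) := by
        gcongr
        exact (Complex.le_def.1 hxx).1
    _ = ‖x‖ * J := by
        rw [Real.sqrt_mul (by positivity), Real.sqrt_sq (norm_nonneg _), mul_left_comm,
          Real.mul_self_sqrt hJ0]

/-- For `x` in the multiplier algebra the functional `g ↦ φ (ι g x)` on `C₀(S)` is given by an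
element of `L^∞(S, μ)`. -/
theorem exists_condExp (φ : A →ₚ[ℂ] ℂ) (ι : C₀(S, ℂ) →⋆ₙₐ[ℂ] A)
    (hι : ∀ (g : C₀(S, ℂ)) (a : A), φ (a * ι g) = φ (ι g * a))
    (μ : Measure S) [IsFiniteMeasure μ] [μ.Regular]
    (hμ : ∀ g : C₀(S, ℂ), ∫ s, g s ∂μ = φ (ι g)) (x : 𝓜(ℂ, A)) :
    ∃ F : Lp ℂ ∞ μ, ∀ g : C₀(S, ℂ), ∫ s, g s * F s ∂μ = φ (x.snd (ι g)) := by
  have hbound := norm_apply_mul_le φ ι hι μ hμ x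
  have hmem : ∀ g : C₀(S, ℂ), MemLp (fun s => g s) 2 μ := fun g =>
    MemLp.of_bound g.toBCF.continuous.aestronglyMeasurable ‖g.toBCF‖
      (ae_of_all _ fun s => g.toBCF.norm_coe_le_norm s)
  let j : C₀(S, ℂ) →ₗ[ℂ] Lp ℂ 2 μ :=
    { toFun := fun g => (hmem g).toLp
      map_add' := fun _ _ => rfl
      map_smul' := fun _ _ => rfl }
  let ℓ : C₀(S, ℂ) →ₗ[ℂ] ℂ :=
    { toFun := fun g => φ (x.snd (ι g))
      map_add' := fun _ _ => by simp
      map_smul' := fun _ _ => by simp }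
  have hdense : DenseRange j := by
    intro u
    refine EMetric.mem_closure_iff.2 fun ε hε => ?_
    obtain ⟨δ, hδ0, hδ⟩ := exists_between hε
    obtain ⟨g, hg, hug, hgc, hgm⟩ :=
      (Lp.memLp u).exists_hasCompactSupport_eLpNorm_sub_le (by simp) hδ0.ne'
    refine ⟨_, ⟨⟨⟨g, hgc⟩, hg.is_zero_at_infty⟩, rfl⟩, lt_of_le_of_lt ?_ hδ⟩
    rw [← Lp.toLp_coeFn u (Lp.memLp u)]
    exact (Lp.edist_toLp_toLp _ _ (Lp.memLp u) (hmem _)).trans_le hug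
  -- `L¹`-norm as a continuous function on `L²`
  have hi : ∀ u : Lp ℂ 2 μ, Integrable (fun s => u s) μ := fun u =>
    (Lp.memLp u).integrable (by norm_num)
  obtain ⟨K, hL1⟩ : ∃ K : ℝ, ∀ u : Lp ℂ 2 μ, ∫ s, ‖u s‖ ∂μ ≤ K * ‖u‖ := by
    refine ⟨(μ Set.univ ^ (1 / (1 : ℝ≥0∞).toReal - 1 / (2 : ℝ≥0∞).toReal)).toReal, fun u => ?_⟩
    have h1 := eLpNorm_le_eLpNorm_mul_rpow_measure_univ (p := 1) (q := 2) (μ := μ) (by norm_num)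
      (Lp.aestronglyMeasurable u)
    rw [integral_norm_eq_lintegral_enorm (Lp.aestronglyMeasurable u),
      ← eLpNorm_one_eq_lintegral_enorm, Lp.norm_def, mul_comm, ← ENNReal.toReal_mul]
    refine ENNReal.toReal_mono (ENNReal.mul_ne_top (Lp.eLpNorm_ne_top u) ?_) h1
    exact ENNReal.rpow_ne_top_of_nonneg (by norm_num) (measure_ne_top μ _)
  have hcont : Continuous fun u : Lp ℂ 2 μ => ∫ s, ‖u s‖ ∂μ := by
    refine (LipschitzWith.of_dist_le' (K := K) fun u v => ?_).continuous
    rw [dist_eq_norm u v, Real.dist_eq, ← integral_sub (hi u).norm (hi v).norm]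
    refine le_trans ?_ (hL1 (u - v))
    refine (abs_integral_le_integral_abs).trans
      (integral_mono_ae ((hi u).norm.sub (hi v).norm).abs (hi _).norm ?_)
    filter_upwards [Lp.coeFn_sub u v] with s hs
    rw [hs]
    exact abs_norm_sub_norm_le _ _
  have hjn : ∀ g, ∫ s, ‖j g s‖ ∂μ = ∫ s, ‖g s‖ ∂μ := fun g =>
    integral_congr_ae ((hmem g).coeFn_toLp.mono fun s hs => by simp only [j]; exact congrArg norm hs)
  have hℓ : ∀ g, ‖ℓ g‖ ≤ ‖x‖ * K * ‖j g‖ := fun g => by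
    rw [mul_assoc]
    exact (hbound g).trans (mul_le_mul_of_nonneg_left ((hjn g).symm.le.trans (hL1 _)) (norm_nonneg _))
  let E : Lp ℂ 2 μ →L[ℂ] ℂ := ℓ.extendOfNorm j
  have hE : ∀ g, E (j g) = ℓ g := fun g => LinearMap.extendOfNorm_eq hdense ⟨_, hℓ⟩ g
  have hE1 : ∀ u, ‖E u‖ ≤ ‖x‖ * ∫ s, ‖u s‖ ∂μ := by
    intro u
    refine hdense.induction_on (p := fun u => ‖E u‖ ≤ ‖x‖ * ∫ s, ‖u s‖ ∂μ) u
      (isClosed_le (by fun_prop) (hcont.const_mul _)) fun g => ?_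
    rw [hE, hjn]
    exact hbound g
  let w : Lp ℂ 2 μ := (InnerProductSpace.toDual ℂ _).symm E
  have hw : ∀ u : Lp ℂ 2 μ, E u = ∫ s, u s * star (w s) ∂μ := by
    intro u
    have : inner ℂ w u = E u := InnerProductSpace.toDual_symm_apply
    rw [← this, L2.inner_def]
    rfl
  have hwn : ∀ᵐ s ∂μ, ‖w s‖ ≤ ‖x‖ := by
    let t : Set S := {s | ‖x‖ < ‖w s‖}
    have ht : MeasurableSet t :=
      measurableSet_lt measurable_const (Lp.stronglyMeasurable w).measurable.norm
    have hm : MemLp (t.indicator fun s => w s) 2 μ := (Lp.memLp w).indicator ht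
    have h1 := hE1 hm.toLp
    have e1 : ∫ s, (hm.toLp : Lp ℂ 2 μ) s * star (w s) ∂μ = ((∫ s, t.indicator (fun s => ‖w s‖ ^ 2) s ∂μ : ℝ) : ℂ) := by
      rw [← integral_complex_ofReal]
      refine integral_congr_ae (hm.coeFn_toLp.mono fun s hs => ?_)
      simp only [hs]
      by_cases h : s ∈ t
      · simp [h, Complex.mul_conj, Complex.normSq_eq_norm_sq]
      · simp [h]
    have e2 : ∫ s, ‖(hm.toLp : Lp ℂ 2 μ) s‖ ∂μ = ∫ s, t.indicator (fun s => ‖w s‖) s ∂μ := by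
      refine integral_congr_ae (hm.coeFn_toLp.mono fun s hs => ?_)
      simp only [hs]
      by_cases h : s ∈ t <;> simp [h]
    have i2 : Integrable (t.indicator fun s => ‖w s‖) μ := (hi w).norm.indicator ht
    have i1 : Integrable (t.indicator fun s => ‖w s‖ ^ 2) μ :=
      (Lp.memLp w).integrable_norm_pow (by norm_num) |>.indicator ht
    rw [hw, e1, e2, Complex.norm_real] at h1
    have h2 := (Real.le_norm_self _).trans h1
    rw [← integral_const_mul, ← sub_nonpos, ← integral_sub i1 (i2.const_mul _)] at h2
    have h3 : ∀ s, 0 ≤ t.indicator (fun s => ‖w s‖ ^ 2) s - ‖x‖ * t.indicator (fun s => ‖w s‖) s := by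
      intro s
      by_cases h : s ∈ t
      · have : ‖x‖ < ‖w s‖ := h
        simp only [h, Set.indicator_of_mem]
        nlinarith [norm_nonneg (w s)]
      · simp [h]
    have h4 := (integral_eq_zero_iff_of_nonneg h3 (i1.sub (i2.const_mul _))).1
      (le_antisymm h2 (integral_nonneg h3))
    filter_upwards [h4] with s hs
    by_contra h
    have hst : s ∈ t := not_le.1 h
    have : ‖x‖ < ‖w s‖ := hst
    simp only [hst, Set.indicator_of_mem, Pi.zero_apply] at hs
    nlinarith [norm_nonneg x]
  have hle : ∀ᵐ s ∂μ, ‖star (w s)‖ ≤ ‖x‖ := by simpa using hwn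
  have hF : MemLp (fun s => star (w s)) ∞ μ :=
    memLp_top_of_bound (Lp.aestronglyMeasurable w).star ‖x‖ hle
  refine ⟨hF.toLp, fun g => ?_⟩
  change _ = ℓ g
  rw [← hE, hw]
  refine integral_congr_ae ?_
  filter_upwards [hF.coeFn_toLp, (hmem g).coeFn_toLp] with s h1 h2
  have h3 : j g s = g s := h2
  rw [h1, h3]

end RieszMeasure

section ConditionalExpectation

variable {A : Type*} [NonUnitalCStarAlgebra A] [PartialOrder A] [StarOrderedRing A]
variable {S : Type*} [TopologicalSpace S] [LocallyCompactSpace S]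
  [TopologicalSpace.MetrizableSpace S] [MeasurableSpace S] [BorelSpace S]

/-- The centralizer `A^φ` of a functional `φ`. -/
def functionalCentralizer (φ : A →ₚ[ℂ] ℂ) : Set A :=
  {y | ∀ x : A, φ (x * y) = φ (y * x)}

/-- The identification `C = C₀(S)`, read as an embedding of `C₀(S)` into `A`. -/
noncomputable def zeroAtInftyEmbedding (C : NonUnitalStarSubalgebra ℂ A) (e : C ≃⋆ₐ[ℂ] C₀(S, ℂ)) :
    C₀(S, ℂ) →⋆ₙₐ[ℂ] A where
  toFun g := (e.symm g : A)
  map_smul' c g := by rw [map_smul]; rfl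
  map_zero' := by simp
  map_add' g h := by simp
  map_mul' g h := by simp
  map_star' g := by rw [map_star]; rfl

/-- The finite Radon measure `μ_φ` on `S` which represents `φ` on `C = C₀(S)`. -/
noncomputable def representingMeasure (φ : A →ₚ[ℂ] ℂ) (C : NonUnitalStarSubalgebra ℂ A)
    (e : C ≃⋆ₐ[ℂ] C₀(S, ℂ)) : Measure S :=
  (exists_representingMeasure φ (zeroAtInftyEmbedding C e)).choose

instance (φ : A →ₚ[ℂ] ℂ) (C : NonUnitalStarSubalgebra ℂ A) (e : C ≃⋆ₐ[ℂ] C₀(S, ℂ)) :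
    IsFiniteMeasure (representingMeasure φ C e) :=
  (exists_representingMeasure φ (zeroAtInftyEmbedding C e)).choose_spec.1

instance (φ : A →ₚ[ℂ] ℂ) (C : NonUnitalStarSubalgebra ℂ A) (e : C ≃⋆ₐ[ℂ] C₀(S, ℂ)) :
    (representingMeasure φ C e).Regular :=
  (exists_representingMeasure φ (zeroAtInftyEmbedding C e)).choose_spec.2.1

/-- `φ(y) = ∫ y(s) dμ_φ(s)` for `y ∈ C = C₀(S)`. -/
theorem integral_representingMeasure (φ : A →ₚ[ℂ] ℂ) (C : NonUnitalStarSubalgebra ℂ A)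
    (e : C ≃⋆ₐ[ℂ] C₀(S, ℂ)) (y : C) : ∫ s, e y s ∂(representingMeasure φ C e) = φ y := by
  have := (exists_representingMeasure φ (zeroAtInftyEmbedding C e)).choose_spec.2.2 (e y)
  have h : zeroAtInftyEmbedding C e (e y) = y := congrArg Subtype.val (e.symm_apply_apply y)
  rwa [h] at this

theorem apply_zeroAtInftyEmbedding_comm (φ : A →ₚ[ℂ] ℂ) (C : NonUnitalStarSubalgebra ℂ A)
    (e : C ≃⋆ₐ[ℂ] C₀(S, ℂ)) (hC : (C : Set A) ⊆ functionalCentralizer φ) (g : C₀(S, ℂ)) (a : A) :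
    φ (a * zeroAtInftyEmbedding C e g) = φ (zeroAtInftyEmbedding C e g * a) :=
  hC (e.symm g).2 a

/-- The conditional expectation `Φ : M(A) → L^∞(S, μ_φ)`: `Φ(x)` is the element of
`L^∞(S, μ_φ)` which represents the functional `z ↦ φ(z x)` on `C = C₀(S)`. -/
noncomputable def condExpectation (φ : A →ₚ[ℂ] ℂ) (C : NonUnitalStarSubalgebra ℂ A)
    (e : C ≃⋆ₐ[ℂ] C₀(S, ℂ)) (hC : (C : Set A) ⊆ functionalCentralizer φ) (x : 𝓜(ℂ, A)) :
    Lp ℂ ∞ (representingMeasure φ C e) :=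
  (exists_condExp φ (zeroAtInftyEmbedding C e) (apply_zeroAtInftyEmbedding_comm φ C e hC)
    (representingMeasure φ C e)
    (exists_representingMeasure φ (zeroAtInftyEmbedding C e)).choose_spec.2.2 x).choose

/-- `∫ z(s) Φ(x)(s) dμ_φ(s) = φ(z x)` for `z ∈ C` and `x ∈ M(A)`. -/
theorem integral_mul_condExpectation (φ : A →ₚ[ℂ] ℂ) (C : NonUnitalStarSubalgebra ℂ A)
    (e : C ≃⋆ₐ[ℂ] C₀(S, ℂ)) (hC : (C : Set A) ⊆ functionalCentralizer φ) (x : 𝓜(ℂ, A)) (z : C) :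
    ∫ s, e z s * condExpectation φ C e hC x s ∂(representingMeasure φ C e) = φ (x.snd z) := by
  have := (exists_condExp φ (zeroAtInftyEmbedding C e) (apply_zeroAtInftyEmbedding_comm φ C e hC)
    (representingMeasure φ C e)
    (exists_representingMeasure φ (zeroAtInftyEmbedding C e)).choose_spec.2.2 x).choose_spec (e z)
  have h : zeroAtInftyEmbedding C e (e z) = z := congrArg Subtype.val (e.symm_apply_apply z)
  rwa [h] at this

end ConditionalExpectation

section WeakStarIntegral

variable {A : Type*} [NonUnitalCStarAlgebra A]
variable {T : Type*} [MeasurableSpace T]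

/-- `m = ∫ b_t dν(t)` in `M(A)` as a weak* integral, that is, tested against the dual `A*` of `A`,
extended to the multiplier algebra (`M(A) ⊆ A**`). By Cohen factorization the extensions to `M(A)`
of the elements of `A*` are exactly the functionals `x ↦ ρ(c x d)` with `ρ ∈ A*` and `c, d ∈ A`. -/
def IsWeakStarIntegral (ν : Measure T) (b : T → 𝓜(ℂ, A)) (m : 𝓜(ℂ, A)) : Prop :=
  ∀ (ρ : A →L[ℂ] ℂ) (c d : A),
    Integrable (fun t => ρ (c * (b t).fst d)) ν ∧
      ∫ t, ρ (c * (b t).fst d) ∂ν = ρ (c * m.fst d)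

/-- A field in `A` is weak* measurable if `t ↦ ρ(x_t)` is `ν`-measurable for each `ρ ∈ A*`. -/
def IsWeakStarMeasurable (ν : Measure T) (x : T → A) : Prop :=
  ∀ ρ : A →L[ℂ] ℂ, AEStronglyMeasurable (fun t => ρ (x t)) ν

/-- A unital column field: a continuous field with `∫ a_t* a_t dν(t) = 1`. Continuity is only asked
for pointwise, `t ↦ a_t d` being norm continuous for each `d ∈ A`; this covers the fields which
are continuous for the norm or for the strict topology of `M(A)`. -/
structure IsUnitalColumnField [TopologicalSpace T] (ν : Measure T) (a : T → 𝓜(ℂ, A)) : Prop where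
  continuous : ∀ d : A, Continuous fun t => (a t).fst d
  integral_eq_one : IsWeakStarIntegral ν (fun t => star (a t) * a t) 1

end WeakStarIntegral

/-!
A continuous convex function on the cube is the supremum of countably many affine minorants
(`ConvexOn.exists_countable_affine_le`), and an affine minorant `l ≤ f` gives `l(x_t) ≤ f(x_t)` in
the multiplier algebra, because the Gelfand transform of the difference is nonnegative
(`exists_star_mul_self_tupleCalculus_sub`). Affine functions commute with the unital column
`b ↦ ∫ a_t* b_t a_t dν(t)` (`IsWeakStarIntegral.affine`) and with `Φ` (`condExpectation_affine`), so
everything reduces to the positivity of `b ↦ Φ(∫ a_t* b_t a_t dν(t))`: it yields `l(Φ(y)) ≤ Φ(z)`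
almost everywhere, simultaneously for the countably many `l`, and the supremum over `l` is the
inequality.

Positivity is obtained by exchanging the two integrals. As `C` lies in the centralizer of `φ`, the
functional `m ↦ ∫ h² Φ(m) dμ` is `m ↦ φ(h m h)` for self-adjoint `h ∈ C`. Letting `h` tend to the
indicator function of a compact set `K` gives `∫_T ∫_K Φ(b_t) dμ dν(t) = ∫_K Φ(∫_T b_t dν(t)) dμ`
for fields of positive elements (`IsWeakStarIntegral.integral_setIntegral_condExpectation`).

That `Φ(yᵢ)` lies in `Iᵢ` follows from the same positivity applied to `xᵢ - α` and `β - xᵢ`. An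
endpoint which does not belong to `Iᵢ` needs strict positivity: if `b_t ≥ δ_t > 0` for every `t`,
with no uniform lower bound, then still `Φ(∫ a_t* b_t a_t dν(t)) > 0` almost everywhere
(`condExpectation_pos_of_isWeakStarIntegral`).
-/

/-! ### Compact sets and finite regular measures -/

section CompactSets

variable {S : Type*} [TopologicalSpace S] [LocallyCompactSpace S]
  [TopologicalSpace.MetrizableSpace S] [MeasurableSpace S] [BorelSpace S]

/-- In a metrizable space `K` is a `Gδ`, hence the set where some Urysohn function equals `1`; its
powers converge to the indicator function of `K`. -/
theorem exists_seq_tendsto_indicator_of_isCompact {K : Set S} (hK : IsCompact K) :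
    ∃ u : ℕ → C_c(S, ℝ), (∀ k s, 0 ≤ u k s ∧ u k s ≤ u 0 s ∧ u 0 s ≤ 1) ∧
      ∀ s, Tendsto (fun k => u k s) atTop (𝓝 (K.indicator 1 s)) := by
  obtain ⟨v, hv1, -, hvc, hv⟩ := exists_continuous_one_zero_of_isCompact_of_isGδ hK
    hK.isClosed.isGδ isClosed_empty (Set.disjoint_empty K)
  refine ⟨fun k => ⟨⟨fun s => v s ^ (k + 1), by fun_prop⟩,
    hvc.comp_left (g := fun r : ℝ => r ^ (k + 1)) (by simp)⟩, fun k s => ⟨?_, ?_, ?_⟩, fun s => ?_⟩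
  · exact pow_nonneg (hv s).1 _
  · exact pow_le_pow_of_le_one (hv s).1 (hv s).2 (by omega)
  · exact pow_le_one₀ (hv s).1 (hv s).2
  · change Tendsto (fun k => v s ^ (k + 1)) atTop _
    by_cases hs : s ∈ K
    · have : v s = 1 := by rw [hv1] at hs; exact hs
      simp [this, hs]
    · have h1 : v s ≠ 1 := fun h => hs (by rw [hv1]; exact h)
      rw [Set.indicator_of_notMem hs]
      exact (tendsto_pow_atTop_nhds_zero_of_lt_one (hv s).1
        (lt_of_le_of_ne (hv s).2 h1)).comp (tendsto_add_atTop_nat 1)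

theorem tendsto_integral_mul_self_mul (μ : Measure S) {K : Set S} (hK : IsCompact K)
    {u : ℕ → C_c(S, ℝ)} (hu : ∀ k s, 0 ≤ u k s ∧ u k s ≤ u 0 s ∧ u 0 s ≤ 1)
    (hlim : ∀ s, Tendsto (fun k => u k s) atTop (𝓝 (K.indicator 1 s)))
    {F : S → ℂ} (hF : Integrable F μ) :
    Tendsto (fun k => ∫ s, ofRealCompact (u k) s * ofRealCompact (u k) s * F s ∂μ) atTop
      (𝓝 (∫ s in K, F s ∂μ)) := by
  rw [← integral_indicator hK.isClosed.measurableSet]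
  refine tendsto_integral_of_dominated_convergence (fun s => ‖F s‖) (fun k => ?_) hF.norm
    (fun k => ae_of_all _ fun s => ?_) (ae_of_all _ fun s => ?_)
  · exact ((map_continuous _).mul (map_continuous _)).aestronglyMeasurable.mul hF.1
  · change ‖(u k s : ℂ) * (u k s : ℂ) * F s‖ ≤ _
    obtain ⟨h0, h1, h2⟩ := hu k s
    rw [norm_mul, norm_mul, Complex.norm_real, Real.norm_of_nonneg h0]
    exact mul_le_of_le_one_left (norm_nonneg _) (mul_le_one₀ (h1.trans h2) h0 (h1.trans h2))
  · change Tendsto (fun k => (u k s : ℂ) * (u k s : ℂ) * F s) atTop _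
    have h := (Complex.continuous_ofReal.tendsto _).comp (hlim s)
    have h2 := (h.mul h).mul_const (F s)
    have h3 : K.indicator F s =
        ((K.indicator 1 s : ℝ) : ℂ) * ((K.indicator 1 s : ℝ) : ℂ) * F s := by
      by_cases hs : s ∈ K <;> simp [hs]
    rw [h3]
    exact h2

/-- A strict inequality holds almost everywhere once it holds for the integrals over all compact
sets of positive measure: if it failed on a set of positive measure, inner regularity would give
a compact set of positive measure on which it fails. -/
theorem ae_pos_of_forall_isCompact (μ : Measure S) [IsFiniteMeasure μ] [μ.Regular] {F : S → ℝ}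
    (hF : Integrable F μ) (h : ∀ K, IsCompact K → μ K ≠ 0 → 0 < ∫ s in K, F s ∂μ) :
    ∀ᵐ s ∂μ, 0 < F s := by
  obtain ⟨G, hG, hFG⟩ := hF.1
  suffices hs : μ {s | G s ≤ 0} = 0 by
    have : ∀ᵐ s ∂μ, ¬ G s ≤ 0 := by simpa [ae_iff] using hs
    filter_upwards [this, hFG] with s h1 h2
    rw [h2]; exact not_le.1 h1
  by_contra hne
  have hmeas : MeasurableSet {s | G s ≤ 0} := measurableSet_le hG.measurable measurable_const
  obtain ⟨K, hKs, hK, hpos⟩ := hmeas.exists_lt_isCompact (μ := μ) (pos_iff_ne_zero.2 hne)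
  have h1 := h K hK hpos.ne'
  rw [setIntegral_congr_ae (g := G) hK.isClosed.measurableSet (hFG.mono fun s hs _ => hs)] at h1
  exact h1.not_ge (setIntegral_nonpos hK.isClosed.measurableSet fun s hs => hKs hs)

theorem ae_nonneg_of_forall_isCompact (μ : Measure S) [IsFiniteMeasure μ] [μ.Regular] {F : S → ℝ}
    (hF : Integrable F μ) (h : ∀ K, IsCompact K → 0 ≤ ∫ s in K, F s ∂μ) :
    ∀ᵐ s ∂μ, 0 ≤ F s := by
  have key : ∀ k : ℕ, ∀ᵐ s ∂μ, 0 < F s + 1 / ((k : ℝ) + 1) := fun k => by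
    refine ae_pos_of_forall_isCompact μ (hF.add (integrable_const _)) fun K hK h0 => ?_
    rw [integral_add hF.integrableOn (integrable_const _), setIntegral_const, smul_eq_mul]
    refine add_pos_of_nonneg_of_pos (h K hK) (mul_pos ?_ Nat.one_div_pos_of_nat)
    exact ENNReal.toReal_pos h0 (measure_ne_top _ _)
  filter_upwards [ae_all_iff.2 key] with s hs
  have h1 : Tendsto (fun k : ℕ => F s + 1 / ((k : ℝ) + 1)) atTop (𝓝 (F s + 0)) :=
    tendsto_const_nhds.add tendsto_one_div_add_atTop_nhds_zero_nat
  rw [add_zero] at h1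
  exact ge_of_tendsto' h1 fun k => (hs k).le

theorem ae_nonneg_complex_of_forall_isCompact (μ : Measure S) [IsFiniteMeasure μ] [μ.Regular]
    {F : S → ℂ} (hF : Integrable F μ) (h : ∀ K, IsCompact K → 0 ≤ ∫ s in K, F s ∂μ) :
    ∀ᵐ s ∂μ, 0 ≤ F s := by
  have hre : ∀ K, ∫ s in K, (F s).re ∂μ = (∫ s in K, F s ∂μ).re := fun K =>
    integral_re (𝕜 := ℂ) hF.integrableOn
  have him : ∀ K, ∫ s in K, (F s).im ∂μ = (∫ s in K, F s ∂μ).im := fun K =>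
    integral_im (𝕜 := ℂ) hF.integrableOn
  have h1 := ae_nonneg_of_forall_isCompact μ (F := fun s => (F s).re) hF.re fun K hK => by
    rw [hre]; exact (Complex.le_def.1 (h K hK)).1
  have h2 := ae_nonneg_of_forall_isCompact μ (F := fun s => (F s).im) hF.im fun K hK => by
    rw [him, ← (Complex.le_def.1 (h K hK)).2]; rfl
  have h3 := ae_nonneg_of_forall_isCompact μ (F := fun s => -(F s).im) hF.im.neg fun K hK => by
    rw [integral_neg, him, ← (Complex.le_def.1 (h K hK)).2]; simp
  filter_upwards [h1, h2, h3] with s h1 h2 h3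
  exact Complex.le_def.2 ⟨h1, le_antisymm h2 (neg_nonneg.1 h3)⟩

theorem ae_eq_of_forall_integral_mul_eq (μ : Measure S) [IsFiniteMeasure μ] [μ.Regular]
    {F G : S → ℂ} (hF : Integrable F μ) (hG : Integrable G μ)
    (h : ∀ g : C₀(S, ℂ), ∫ s, g s * F s ∂μ = ∫ s, g s * G s ∂μ) : F =ᵐ[μ] G := by
  have hK : ∀ K, IsCompact K → ∫ s in K, F s ∂μ = ∫ s in K, G s ∂μ := fun K hK => by
    obtain ⟨u, hu, hlim⟩ := exists_seq_tendsto_indicator_of_isCompact hK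
    refine tendsto_nhds_unique (tendsto_integral_mul_self_mul μ hK hu hlim hF) ?_
    refine (tendsto_integral_mul_self_mul μ hK hu hlim hG).congr fun k => ?_
    exact (h (ofRealCompact (u k) * ofRealCompact (u k))).symm
  have h1 := ae_nonneg_complex_of_forall_isCompact μ (hF.sub hG) fun K hKc => by
    rw [Pi.sub_def, integral_sub hF.integrableOn hG.integrableOn, hK K hKc, sub_self]
  have h2 := ae_nonneg_complex_of_forall_isCompact μ (hG.sub hF) fun K hKc => by
    rw [Pi.sub_def, integral_sub hG.integrableOn hF.integrableOn, hK K hKc, sub_self]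
  filter_upwards [h1, h2] with s h1 h2
  exact le_antisymm (sub_nonneg.1 h2) (sub_nonneg.1 h1)

end CompactSets

/-! ### Affine minorants of convex functions -/

section AffineMinorants

variable {E : Type*} [AddCommGroup E] [Module ℝ E] [TopologicalSpace E] [IsTopologicalAddGroup E]
  [ContinuousSMul ℝ E] [LocallyConvexSpace ℝ E]

/-- The domain `D` need not be closed: continuity of `f` at `p` keeps `(p, r)` away from
the closure of the epigraph, from which it is separated by a hyperplane. -/
theorem ConvexOn.exists_affine_le_of_lt_of_continuousOn {D : Set E} {f : E → ℝ}
    (hf : ConvexOn ℝ D f) (hc : ContinuousOn f D) {p : E} (hp : p ∈ D) {r : ℝ} (hr : r < f p) :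
    ∃ (l : E →L[ℝ] ℝ) (d : ℝ), (∀ q ∈ D, l q + d ≤ f q) ∧ r < l p + d := by
  let A : Set (E × ℝ) := {q | q.1 ∈ D ∧ f q.1 ≤ q.2}
  have hpA : (p, r) ∉ closure A := by
    obtain ⟨r', hr1, hr2⟩ := exists_between hr
    have h1 : ∀ᶠ q in 𝓝 p, q ∈ D → r' < f q :=
      eventually_nhdsWithin_iff.1 ((hc p hp).eventually (lt_mem_nhds hr2))
    have h2 : ∀ᶠ q in 𝓝 (p, r), q ∉ A := by
      rw [nhds_prod_eq]
      filter_upwards [h1.prod_mk (gt_mem_nhds hr1)] with q hq hqA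
      linarith [hq.1 hqA.1, hq.2, hqA.2]
    rw [mem_closure_iff_frequently]
    exact fun h => h h2
  obtain ⟨L, b, hb, hbA⟩ :=
    geometric_hahn_banach_point_closed hf.convex_epigraph.closure isClosed_closure hpA
  have hL : ∀ (q : E) (v : ℝ), L (q, v) = L (q, 0) + v * L (0, 1) := fun q v => by
    have : (q, v) = (q, (0 : ℝ)) + v • ((0 : E), (1 : ℝ)) := by simp
    rw [this, map_add, map_smul, smul_eq_mul]
  have hA : ∀ q ∈ D, b < L (q, 0) + f q * L (0, 1) := fun q hq => by
    rw [← hL]; exact hbA _ (subset_closure ⟨hq, le_rfl⟩)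
  rw [hL] at hb
  have hβ : 0 < L (0, 1) := by
    have := hb.trans (hA p hp)
    -- `(p, r)` lies strictly below `(p, f p)`, so the separating hyperplane is not vertical.
    have h3 : 0 < (f p - r) * L (0, 1) := by linarith
    exact (pos_iff_pos_of_mul_pos h3).1 (sub_pos.2 hr)
  refine ⟨-(L (0, 1))⁻¹ • L.comp (ContinuousLinearMap.inl ℝ E ℝ), (L (0, 1))⁻¹ * b,
    fun q hq => ?_, ?_⟩
  · have : -(L (0, 1))⁻¹ * L (q, 0) + (L (0, 1))⁻¹ * b = (b - L (q, 0)) / L (0, 1) := by ring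
    simp only [smul_apply, ContinuousLinearMap.comp_apply, ContinuousLinearMap.inl_apply,
      smul_eq_mul]
    rw [this, div_le_iff₀ hβ]
    linarith [hA q hq]
  · have : -(L (0, 1))⁻¹ * L (p, 0) + (L (0, 1))⁻¹ * b = (b - L (p, 0)) / L (0, 1) := by ring
    simp only [smul_apply, ContinuousLinearMap.comp_apply, ContinuousLinearMap.inl_apply,
      smul_eq_mul]
    rw [this, lt_div_iff₀ hβ]
    linarith

/-- Countably many affine minorants suffice because the strict hypograph is Lindelöf. -/
theorem ConvexOn.exists_countable_affine_le [SecondCountableTopology E] {D : Set E} {f : E → ℝ}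
    (hf : ConvexOn ℝ D f) (hc : ContinuousOn f D) :
    ∃ J : Set ((E →L[ℝ] ℝ) × ℝ), J.Countable ∧ (∀ j ∈ J, ∀ q ∈ D, j.1 q + j.2 ≤ f q) ∧
      ∀ p ∈ D, ∀ r < f p, ∃ j ∈ J, r < j.1 p + j.2 := by
  let J₀ : Set ((E →L[ℝ] ℝ) × ℝ) := {j | ∀ q ∈ D, j.1 q + j.2 ≤ f q}
  let U : J₀ → Set (E × ℝ) := fun j => {q | q.2 < j.1.1 q.1 + j.1.2}
  obtain ⟨J, hJ, hJU⟩ := TopologicalSpace.isOpen_iUnion_countable U fun j =>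
    isOpen_lt continuous_snd ((j.1.1.continuous.comp continuous_fst).add continuous_const)
  refine ⟨Subtype.val '' J, hJ.image _, ?_, fun p hp r hr => ?_⟩
  · rintro _ ⟨j, -, rfl⟩
    exact j.2
  · obtain ⟨l, d, h1, h2⟩ := hf.exists_affine_le_of_lt_of_continuousOn hc hp hr
    have h3 : (p, r) ∈ ⋃ j, U j := Set.mem_iUnion.2 ⟨⟨(l, d), h1⟩, h2⟩
    rw [← hJU] at h3
    obtain ⟨j, hj, hjU⟩ := Set.mem_iUnion₂.1 h3
    exact ⟨j, ⟨j, hj, rfl⟩, hjU⟩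

end AffineMinorants

/-! ### The conditional expectation -/

section ConditionalExpectation

theorem exists_star_mul_self_conj {B : Type*} [Semigroup B] [StarMul B] (a : B) {b : B}
    (hb : ∃ k, b = star k * k) : ∃ k, star a * b * a = star k * k := by
  obtain ⟨k, rfl⟩ := hb
  exact ⟨k * a, by rw [star_mul]; simp only [mul_assoc]⟩

variable {A : Type*} [NonUnitalCStarAlgebra A] [PartialOrder A] [StarOrderedRing A]
variable {S : Type*} [TopologicalSpace S] [LocallyCompactSpace S]
  [TopologicalSpace.MetrizableSpace S] [MeasurableSpace S] [BorelSpace S]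
variable (φ : A →ₚ[ℂ] ℂ) (C : NonUnitalStarSubalgebra ℂ A) (e : C ≃⋆ₐ[ℂ] C₀(S, ℂ))
  (hC : (C : Set A) ⊆ functionalCentralizer φ)

theorem integrable_condExpectation (m : 𝓜(ℂ, A)) :
    Integrable (fun s => condExpectation φ C e hC m s) (representingMeasure φ C e) :=
  (Lp.memLp _).integrable (by simp)

theorem integral_mul_condExpectation' (m : 𝓜(ℂ, A)) (g : C₀(S, ℂ)) :
    ∫ s, g s * condExpectation φ C e hC m s ∂(representingMeasure φ C e)
      = φ (m.snd (zeroAtInftyEmbedding C e g)) := by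
  have := integral_mul_condExpectation φ C e hC m (e.symm g)
  rwa [e.apply_symm_apply] at this

theorem integrable_mul_condExpectation (m : 𝓜(ℂ, A)) (g : C₀(S, ℂ)) :
    Integrable (fun s => g s * condExpectation φ C e hC m s) (representingMeasure φ C e) :=
  (integrable_condExpectation φ C e hC m).bdd_mul (c := ‖g.toBCF‖)
    g.toBCF.continuous.aestronglyMeasurable (ae_of_all _ fun s => g.toBCF.norm_coe_le_norm s)

theorem condExpectation_ae_eq {m : 𝓜(ℂ, A)} {F : S → ℂ}
    (hF : Integrable F (representingMeasure φ C e))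
    (h : ∀ g : C₀(S, ℂ), ∫ s, g s * F s ∂(representingMeasure φ C e)
      = φ (m.snd (zeroAtInftyEmbedding C e g))) :
    condExpectation φ C e hC m =ᵐ[representingMeasure φ C e] F :=
  ae_eq_of_forall_integral_mul_eq _ (integrable_condExpectation φ C e hC m) hF fun g => by
    rw [h, integral_mul_condExpectation']

theorem condExpectation_add (m m' : 𝓜(ℂ, A)) :
    condExpectation φ C e hC (m + m') =ᵐ[representingMeasure φ C e]
      fun s => condExpectation φ C e hC m s + condExpectation φ C e hC m' s := by
  refine condExpectation_ae_eq φ C e hC ((integrable_condExpectation φ C e hC m).add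
    (integrable_condExpectation φ C e hC m')) fun g => ?_
  simp_rw [mul_add]
  rw [integral_add (integrable_mul_condExpectation φ C e hC m g)
    (integrable_mul_condExpectation φ C e hC m' g), integral_mul_condExpectation',
    integral_mul_condExpectation', DoubleCentralizer.add_snd, add_apply, map_add]

theorem condExpectation_smul (c : ℂ) (m : 𝓜(ℂ, A)) :
    condExpectation φ C e hC (c • m) =ᵐ[representingMeasure φ C e]
      fun s => c * condExpectation φ C e hC m s := by
  refine condExpectation_ae_eq φ C e hC ((integrable_condExpectation φ C e hC m).const_mul c)
    fun g => ?_
  simp_rw [mul_left_comm _ c]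
  rw [integral_const_mul, integral_mul_condExpectation', DoubleCentralizer.smul_snd, smul_apply,
    map_smul, smul_eq_mul]

theorem condExpectation_zero :
    condExpectation φ C e hC 0 =ᵐ[representingMeasure φ C e] fun _ => 0 := by
  simpa using condExpectation_smul φ C e hC 0 0

theorem condExpectation_sum {κ : Type*} (F : Finset κ) (m : κ → 𝓜(ℂ, A)) :
    condExpectation φ C e hC (∑ i ∈ F, m i) =ᵐ[representingMeasure φ C e]
      fun s => ∑ i ∈ F, condExpectation φ C e hC (m i) s := by
  classical
  induction F using Finset.induction_on with
  | empty => simpa using condExpectation_zero φ C e hC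
  | insert i F hi ih =>
    rw [Finset.sum_insert hi]
    filter_upwards [condExpectation_add φ C e hC (m i) (∑ i ∈ F, m i), ih] with s h1 h2
    rw [h1, h2, Finset.sum_insert hi]

theorem condExpectation_one :
    condExpectation φ C e hC 1 =ᵐ[representingMeasure φ C e] fun _ => 1 := by
  refine condExpectation_ae_eq φ C e hC (integrable_const _) fun g => ?_
  have := integral_representingMeasure φ C e (e.symm g)
  rw [e.apply_symm_apply] at this
  simp_rw [mul_one]
  exact this

/-- Since `C` lies in the centralizer of `φ`, the functional `m ↦ ∫ h² Φ(m) dμ` is `m ↦ φ(h m h)`,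
which is positive for self-adjoint `h` and against which weak* integrals may be tested. -/
theorem apply_mul_fst_zeroAtInftyEmbedding (m : 𝓜(ℂ, A)) (h : C₀(S, ℂ)) :
    φ (zeroAtInftyEmbedding C e h * m.fst (zeroAtInftyEmbedding C e h)) =
      ∫ s, h s * h s * condExpectation φ C e hC m s ∂(representingMeasure φ C e) := by
  have := integral_mul_condExpectation' φ C e hC m (h * h)
  rw [map_mul, multiplier_snd_mul, ← apply_zeroAtInftyEmbedding_comm φ C e hC, m.central] at this
  exact this.symm

theorem condExpectation_nonneg {m : 𝓜(ℂ, A)} (hm : ∃ k, m = star k * k) :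
    ∀ᵐ s ∂(representingMeasure φ C e), 0 ≤ condExpectation φ C e hC m s := by
  obtain ⟨k, rfl⟩ := hm
  refine ae_nonneg_complex_of_forall_isCompact _ (integrable_condExpectation φ C e hC _)
    fun K hK => ?_
  obtain ⟨u, hu, hlim⟩ := exists_seq_tendsto_indicator_of_isCompact hK
  refine ge_of_tendsto' (tendsto_integral_mul_self_mul _ hK hu hlim
    (integrable_condExpectation φ C e hC _)) fun j => ?_
  rw [← apply_mul_fst_zeroAtInftyEmbedding]
  set a := zeroAtInftyEmbedding C e (ofRealCompact (u j)) with ha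
  have hstar : star a = a := by
    rw [ha, ← map_star]
    congr 1
    ext s
    exact Complex.conj_ofReal _
  have : a * (star k * k).fst a = star (k.fst a) * k.fst a := by
    rw [star_multiplier_fst_mul, DoubleCentralizer.mul_fst, hstar]
    rfl
  rw [this]
  exact φ.map_nonneg (star_mul_self_nonneg _)

variable {T : Type*} [MeasurableSpace T] {ν : Measure T}

/-- A Fubini property for fields of positive elements: for compact `K` the functional
`m ↦ ∫_K Φ(m) dμ` is the limit of the functionals `m ↦ φ(hⱼ m hⱼ)`, which commute with weak*
integrals, and on positive elements these are dominated by the first of them. -/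
theorem IsWeakStarIntegral.integral_setIntegral_condExpectation {b : T → 𝓜(ℂ, A)} {m : 𝓜(ℂ, A)}
    (hm : IsWeakStarIntegral ν b m) (hb : ∀ t, ∃ k, b t = star k * k) {K : Set S}
    (hK : IsCompact K) :
    Integrable (fun t => ∫ s in K, condExpectation φ C e hC (b t) s ∂(representingMeasure φ C e)) ν ∧
      ∫ t, ∫ s in K, condExpectation φ C e hC (b t) s ∂(representingMeasure φ C e) ∂ν =
        ∫ s in K, condExpectation φ C e hC m s ∂(representingMeasure φ C e) := by
  obtain ⟨u, hu, hlim⟩ := exists_seq_tendsto_indicator_of_isCompact hK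
  set μ := representingMeasure φ C e
  set ι := zeroAtInftyEmbedding C e
  let a : ℕ → A := fun j => ι (ofRealCompact (u j))
  have hlimit : ∀ m, Tendsto (fun j => φ (a j * m.fst (a j))) atTop
      (𝓝 (∫ s in K, condExpectation φ C e hC m s ∂μ)) := fun m =>
    (tendsto_integral_mul_self_mul μ hK hu hlim (integrable_condExpectation φ C e hC m)).congr
      fun j => (apply_mul_fst_zeroAtInftyEmbedding φ C e hC m _).symm
  have hdom : ∀ j t, ‖φ (a j * (b t).fst (a j))‖ ≤ ‖φ (a 0 * (b t).fst (a 0))‖ := by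
    intro j t
    have hi := fun j => (integrable_mul_condExpectation φ C e hC (b t)
      (ofRealCompact (u j) * ofRealCompact (u j)))
    have hpos := condExpectation_nonneg φ C e hC (hb t)
    have h0 : ∫ s, ofRealCompact (u 0) s * ofRealCompact (u 0) s *
        condExpectation φ C e hC (b t) s ∂μ =
        ((∫ s, ‖ofRealCompact (u 0) s * ofRealCompact (u 0) s *
          condExpectation φ C e hC (b t) s‖ ∂μ : ℝ) : ℂ) := by
      rw [← integral_complex_ofReal]
      refine integral_congr_ae (hpos.mono fun s hs => ?_)
      have h1 : 0 ≤ ofRealCompact (u 0) s := Complex.zero_le_real.2 (hu 0 s).1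
      exact Complex.eq_coe_norm_of_nonneg (mul_nonneg (mul_nonneg h1 h1) hs)
    have h1 : ∀ j, φ (a j * (b t).fst (a j)) = ∫ s, ofRealCompact (u j) s * ofRealCompact (u j) s *
        condExpectation φ C e hC (b t) s ∂μ := fun j =>
      apply_mul_fst_zeroAtInftyEmbedding φ C e hC (b t) _
    rw [h1 j, h1 0, h0, Complex.norm_real]
    refine (norm_integral_le_integral_norm _).trans (le_trans ?_ (Real.le_norm_self _))
    refine integral_mono (hi j).norm (hi 0).norm fun s => ?_
    obtain ⟨h2, h3, -⟩ := hu j s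
    have h4 : 0 ≤ u 0 s := (hu 0 s).1
    change ‖(u j s : ℂ) * (u j s : ℂ) * _‖ ≤ ‖(u 0 s : ℂ) * (u 0 s : ℂ) * _‖
    simp only [norm_mul, Complex.norm_real, Real.norm_of_nonneg h2, Real.norm_of_nonneg h4]
    gcongr
  have hφ : Continuous φ := map_continuous φ
  let ρ : A →L[ℂ] ℂ := ⟨φ.toLinearMap, hφ⟩
  have hint : ∀ j, Integrable (fun t => φ (a j * (b t).fst (a j))) ν ∧
      ∫ t, φ (a j * (b t).fst (a j)) ∂ν = φ (a j * m.fst (a j)) := fun j => hm ρ (a j) (a j)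
  refine ⟨(hint 0).1.mono (aestronglyMeasurable_of_tendsto_ae atTop (fun j => (hint j).1.1)
    (ae_of_all _ fun t => hlimit (b t))) (ae_of_all _ fun t =>
      le_of_tendsto' (hlimit (b t)).norm fun j => hdom j t), ?_⟩
  refine tendsto_nhds_unique (tendsto_integral_of_dominated_convergence _ (fun j => (hint j).1.1)
    (hint 0).1.norm (fun j => ae_of_all _ fun t => hdom j t)
    (ae_of_all _ fun t => hlimit (b t))) ?_
  exact (hlimit m).congr fun j => (hint j).2.symm

theorem condExpectation_nonneg_of_isWeakStarIntegral {a b : T → 𝓜(ℂ, A)} {m : 𝓜(ℂ, A)}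
    (hm : IsWeakStarIntegral ν (fun t => star (a t) * b t * a t) m)
    (hb : ∀ t, ∃ k, b t = star k * k) :
    ∀ᵐ s ∂(representingMeasure φ C e), 0 ≤ condExpectation φ C e hC m s := by
  have hb' := fun t => exists_star_mul_self_conj (a t) (hb t)
  refine ae_nonneg_complex_of_forall_isCompact _ (integrable_condExpectation φ C e hC _)
    fun K hK => ?_
  rw [← (hm.integral_setIntegral_condExpectation φ C e hC hb' hK).2]
  refine integral_nonneg fun t => ?_
  exact integral_nonneg_of_ae (ae_restrict_of_ae (condExpectation_nonneg φ C e hC (hb' t)))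

/-- If `∫_K Φ(m) dμ` vanished for a compact set `K` of positive measure, then so would
`∫_K Φ(a_t* a_t) dμ` for almost every `t`, and integration over `t` would give
`∫_K Φ(1) dμ = μ(K) = 0`. The lower bounds `δ_t` need not be uniform in `t`. -/
theorem condExpectation_pos_of_isWeakStarIntegral {a b : T → 𝓜(ℂ, A)} {m : 𝓜(ℂ, A)}
    (ha : IsWeakStarIntegral ν (fun t => star (a t) * a t) 1)
    (hm : IsWeakStarIntegral ν (fun t => star (a t) * b t * a t) m)
    (hb : ∀ t, ∃ δ : ℝ, 0 < δ ∧ ∃ k, b t = star k * k + (δ : ℂ) • 1) :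
    ∀ᵐ s ∂(representingMeasure φ C e), 0 < condExpectation φ C e hC m s := by
  set μ := representingMeasure φ C e
  choose δ hδ k hk using hb
  have hb2 : ∀ t, ∃ k, b t = star k * k := fun t => by
    let _ : PartialOrder 𝓜(ℂ, A) := CStarAlgebra.spectralOrder _
    have _ : StarOrderedRing 𝓜(ℂ, A) := CStarAlgebra.spectralOrderedRing _
    refine CStarAlgebra.nonneg_iff_eq_star_mul_self.1 ?_
    rw [hk]
    refine add_nonneg (star_mul_self_nonneg _) ?_
    have : ((δ t : ℝ) : ℂ) • (1 : 𝓜(ℂ, A)) = star (((√(δ t) : ℝ) : ℂ) • (1 : 𝓜(ℂ, A))) *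
        (((√(δ t) : ℝ) : ℂ) • (1 : 𝓜(ℂ, A))) := by
      rw [star_smul, star_one, smul_mul_smul_comm, one_mul, Complex.star_def, Complex.conj_ofReal,
        ← Complex.ofReal_mul, Real.mul_self_sqrt (hδ t).le]
    rw [this]
    exact star_mul_self_nonneg _
  have hb' := fun t => exists_star_mul_self_conj (a t) (hb2 t)
  have hnn := condExpectation_nonneg_of_isWeakStarIntegral φ C e hC hm hb2
  have hi := integrable_condExpectation φ C e hC
  have hre : ∀ᵐ s ∂μ, 0 < (condExpectation φ C e hC m s).re := by
    refine ae_pos_of_forall_isCompact μ (hi m).re fun K hK hμK => ?_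
    let Ψ : 𝓜(ℂ, A) → ℝ := fun m => (∫ s in K, condExpectation φ C e hC m s ∂μ).re
    have hΨ : ∀ {m}, (∃ k, m = star k * k) → 0 ≤ Ψ m := fun hm =>
      (Complex.le_def.1 (integral_nonneg_of_ae
        (ae_restrict_of_ae (condExpectation_nonneg φ C e hC hm)))).1
    have hF : ∀ {b : T → 𝓜(ℂ, A)} {m}, IsWeakStarIntegral ν b m →
        (∀ t, ∃ k, b t = star k * k) →
        Integrable (fun t => Ψ (b t)) ν ∧ ∫ t, Ψ (b t) ∂ν = Ψ m := fun hm hb => by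
      have h1 := hm.integral_setIntegral_condExpectation φ C e hC hb hK
      exact ⟨h1.1.re, (integral_re (𝕜 := ℂ) h1.1).trans (congrArg Complex.re h1.2)⟩
    have hgoal : ∫ s in K, (condExpectation φ C e hC m s).re ∂μ = Ψ m :=
      integral_re (𝕜 := ℂ) (hi m).integrableOn
    rw [hgoal]
    obtain ⟨h1, h2⟩ := hF hm hb'
    obtain ⟨h3, h4⟩ := hF ha fun t => ⟨a t, rfl⟩
    have hle : ∀ t, δ t * Ψ (star (a t) * a t) ≤ Ψ (star (a t) * b t * a t) := fun t => by
      have e1 : star (a t) * b t * a t =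
          star (k t * a t) * (k t * a t) + (δ t : ℂ) • (star (a t) * a t) := by
        rw [hk, star_mul, mul_add, add_mul, mul_smul_comm, mul_one, smul_mul_assoc]
        simp only [mul_assoc]
      have e2 : Ψ (star (a t) * b t * a t) =
          Ψ (star (k t * a t) * (k t * a t)) + δ t * Ψ (star (a t) * a t) := by
        simp only [Ψ]
        rw [e1, setIntegral_congr_ae hK.isClosed.measurableSet
          ((condExpectation_add φ C e hC _ _).mono fun s hs _ => hs),
          integral_add (hi _).integrableOn (hi _).integrableOn,
          setIntegral_congr_ae hK.isClosed.measurableSet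
          ((condExpectation_smul φ C e hC _ _).mono fun s hs _ => hs), integral_const_mul,
          Complex.add_re, Complex.re_ofReal_mul]
      rw [e2]
      linarith [hΨ ⟨k t * a t, rfl⟩]
    have hnonneg : ∀ t, 0 ≤ Ψ (star (a t) * b t * a t) := fun t => hΨ (hb' t)
    refine lt_of_le_of_ne (h2 ▸ integral_nonneg hnonneg) fun hzero => ?_
    rw [← h2, eq_comm, integral_eq_zero_iff_of_nonneg hnonneg h1] at hzero
    have h5 : ∫ t, Ψ (star (a t) * a t) ∂ν = 0 := by
      refine integral_eq_zero_of_ae (hzero.mono fun t ht => ?_)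
      have h6 := (hle t).trans_eq ht
      exact le_antisymm (nonpos_of_mul_nonpos_right h6 (hδ t)) (hΨ ⟨a t, rfl⟩)
    rw [h4] at h5
    have h7 : Ψ 1 = μ.real K := by
      simp only [Ψ]
      rw [setIntegral_congr_ae hK.isClosed.measurableSet
          ((condExpectation_one φ C e hC).mono fun s hs _ => hs)]
      simp [μ]
    rw [h7] at h5
    exact (ENNReal.toReal_pos hμK (measure_ne_top _ _)).ne' h5
  filter_upwards [hnn, hre] with s h1 h2
  exact Complex.lt_def.2 ⟨h2, (Complex.le_def.1 h1).2⟩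

end ConditionalExpectation

/-! ### Linearity of weak* integrals -/

section WeakStarIntegral

variable {A : Type*} [NonUnitalCStarAlgebra A] {T : Type*} [MeasurableSpace T] {ν : Measure T}

theorem IsWeakStarIntegral.add {b b' : T → 𝓜(ℂ, A)} {m m' : 𝓜(ℂ, A)}
    (h : IsWeakStarIntegral ν b m) (h' : IsWeakStarIntegral ν b' m') :
    IsWeakStarIntegral ν (fun t => b t + b' t) (m + m') := fun ρ c d => by
  simp only [DoubleCentralizer.add_fst, add_apply, mul_add, map_add]
  refine ⟨(h ρ c d).1.add (h' ρ c d).1, ?_⟩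
  rw [integral_add (h ρ c d).1 (h' ρ c d).1, (h ρ c d).2, (h' ρ c d).2]

theorem IsWeakStarIntegral.smul {b : T → 𝓜(ℂ, A)} {m : 𝓜(ℂ, A)}
    (h : IsWeakStarIntegral ν b m) (r : ℂ) :
    IsWeakStarIntegral ν (fun t => r • b t) (r • m) := fun ρ c d => by
  simp only [DoubleCentralizer.smul_fst, smul_apply, mul_smul_comm, map_smul]
  refine ⟨(h ρ c d).1.smul r, ?_⟩
  rw [integral_smul, (h ρ c d).2]

theorem isWeakStarIntegral_zero : IsWeakStarIntegral ν (fun _ => (0 : 𝓜(ℂ, A))) 0 := fun ρ c d => by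
  simp

theorem IsWeakStarIntegral.sum {κ : Type*} (F : Finset κ) {b : κ → T → 𝓜(ℂ, A)}
    {m : κ → 𝓜(ℂ, A)} (h : ∀ i, IsWeakStarIntegral ν (b i) (m i)) :
    IsWeakStarIntegral ν (fun t => ∑ i ∈ F, b i t) (∑ i ∈ F, m i) := by
  classical
  induction F using Finset.induction_on with
  | empty => simpa using isWeakStarIntegral_zero
  | insert i F hi ih =>
    simp_rw [Finset.sum_insert hi]
    exact (h i).add ih

theorem IsWeakStarIntegral.affine {κ : Type*} [Fintype κ]
    {a : T → 𝓜(ℂ, A)}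
    (ha : IsWeakStarIntegral ν (fun t => star (a t) * a t) 1) {b : κ → T → 𝓜(ℂ, A)}
    {y : κ → 𝓜(ℂ, A)} (hy : ∀ i, IsWeakStarIntegral ν (fun t => star (a t) * b i t * a t) (y i))
    (c : κ → ℂ) (d : ℂ) :
    IsWeakStarIntegral ν (fun t => star (a t) * (∑ i, c i • b i t + d • 1) * a t)
      (∑ i, c i • y i + d • 1) := by
  have h := (IsWeakStarIntegral.sum Finset.univ fun i => (hy i).smul (c i)).add (ha.smul d)
  convert h using 2 with t
  simp only [mul_add, add_mul, Finset.mul_sum, Finset.sum_mul, mul_smul_comm, smul_mul_assoc,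
    mul_one]

end WeakStarIntegral

/-! ### Positive elements of `C*`-algebras -/

section Positivity

variable {B : Type*} [CStarAlgebra B]

theorem algebraMap_real_eq_ofReal_smul_one (r : ℝ) : algebraMap ℝ B r = (r : ℂ) • (1 : B) := by
  rw [IsScalarTower.algebraMap_apply ℝ ℂ B, Algebra.algebraMap_eq_smul_one]; rfl

theorem IsSelfAdjoint.exists_star_mul_self_of_le_spectrum {b : B} (hb : IsSelfAdjoint b) {α : ℝ}
    (h : ∀ r ∈ spectrum ℝ b, α ≤ r) : ∃ k, b + (-α : ℂ) • 1 = star k * k := by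
  let _ : PartialOrder B := CStarAlgebra.spectralOrder _
  have _ : StarOrderedRing B := CStarAlgebra.spectralOrderedRing _
  refine CStarAlgebra.nonneg_iff_eq_star_mul_self.1 ?_
  rw [neg_smul, ← sub_eq_add_neg, ← algebraMap_real_eq_ofReal_smul_one, sub_nonneg]
  exact (algebraMap_le_iff_le_spectrum hb).2 h

theorem IsSelfAdjoint.exists_star_mul_self_add_of_lt_spectrum {b : B} (hb : IsSelfAdjoint b)
    {α : ℝ} (h : ∀ r ∈ spectrum ℝ b, α < r) :
    ∃ δ : ℝ, 0 < δ ∧ ∃ k, b + (-α : ℂ) • 1 = star k * k + (δ : ℂ) • 1 := by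
  obtain ⟨δ, hδ, hle⟩ : ∃ δ : ℝ, 0 < δ ∧ ∀ r ∈ spectrum ℝ b, α + δ ≤ r := by
    rcases (spectrum ℝ b).eq_empty_or_nonempty with h0 | h0
    · exact ⟨1, one_pos, by simp [h0]⟩
    · obtain ⟨r, hr, hmin⟩ := (spectrum.isCompact b).exists_isMinOn h0 continuous_id.continuousOn
      exact ⟨r - α, sub_pos.2 (h r hr), fun r' hr' => by simpa using hmin hr'⟩
  obtain ⟨k, hk⟩ := hb.exists_star_mul_self_of_le_spectrum hle
  refine ⟨δ, hδ, k, ?_⟩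
  rw [← hk, add_assoc, ← add_smul]
  congr 2
  push_cast
  ring

theorem IsSelfAdjoint.exists_star_mul_self_add_of_norm_le {b : B} (hb : IsSelfAdjoint b) {M : ℝ}
    (h : ‖b‖ ≤ M) : ∃ k, b + (M : ℂ) • 1 = star k * k := by
  let _ : PartialOrder B := CStarAlgebra.spectralOrder _
  have _ : StarOrderedRing B := CStarAlgebra.spectralOrderedRing _
  refine CStarAlgebra.nonneg_iff_eq_star_mul_self.1 ?_
  rw [← algebraMap_real_eq_ofReal_smul_one, ← neg_le_iff_add_nonneg]
  exact (neg_le_neg (algebraMap_mono B h)).trans hb.neg_algebraMap_norm_le_self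

variable {n : ℕ}

theorem tupleAlgebra_mul_comm {x : Fin n → B} (hcomm : ∀ i j, Commute (x i) (x j))
    (hsa : ∀ i, IsSelfAdjoint (x i)) (a b : tupleAlgebra x) : a * b = b * a := by
  have hc : ∀ a b : StarAlgebra.adjoin ℂ (Set.range x), a * b = b * a := by
    have : IsMulCommutative (StarAlgebra.adjoin ℂ (Set.range x)) :=
      StarAlgebra.isMulCommutative_adjoin ℂ
        (by rintro _ ⟨i, rfl⟩ _ ⟨j, rfl⟩; exact hcomm i j)
        (by rintro _ ⟨i, rfl⟩ _ ⟨j, rfl⟩; rw [(hsa j).star_eq]; exact hcomm i j)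
    exact fun a b => this.is_comm.comm a b
  let _ : CommRing (tupleAlgebra x) := StarSubalgebra.commRingTopologicalClosure _ hc
  exact mul_comm a b

theorem character_apply_mem_spectrum {x : Fin n → B} (hsa : ∀ i, IsSelfAdjoint (x i))
    (χ : WeakDual.characterSpace ℂ (tupleAlgebra x)) (i : Fin n) :
    ((χ ⟨x i, mem_tupleAlgebra x i⟩).re : ℂ) = χ ⟨x i, mem_tupleAlgebra x i⟩ ∧
      (χ ⟨x i, mem_tupleAlgebra x i⟩).re ∈ spectrum ℝ (x i) := by
  have hcl : IsClosed (tupleAlgebra x : Set B) := StarSubalgebra.isClosed_topologicalClosure _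
  let _ : CStarAlgebra (tupleAlgebra x) := StarSubalgebra.cstarAlgebra _ (h_closed := hcl)
  have h1 : χ ⟨x i, mem_tupleAlgebra x i⟩ ∈ spectrum ℂ (x i) := by
    have := AlgHom.apply_mem_spectrum χ (⟨x i, mem_tupleAlgebra x i⟩ : tupleAlgebra x)
    rwa [StarSubalgebra.spectrum_eq (hS := hcl)] at this
  have h2 := (hsa i).mem_spectrum_eq_re h1
  refine ⟨h2.symm, ?_⟩
  rw [h2] at h1
  exact (spectrum.algebraMap_mem_iff ℂ (R := ℝ)).1 h1

theorem exists_star_mul_self_of_forall_character_nonneg {x : Fin n → B}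
    (hcomm : ∀ i j, Commute (x i) (x j)) (hsa : ∀ i, IsSelfAdjoint (x i)) (v : tupleAlgebra x)
    (hv : ∀ χ : WeakDual.characterSpace ℂ (tupleAlgebra x), 0 ≤ χ v) :
    ∃ k : B, (v : B) = star k * k := by
  have hcl : IsClosed (tupleAlgebra x : Set B) := StarSubalgebra.isClosed_topologicalClosure _
  let _ : CStarAlgebra (tupleAlgebra x) := StarSubalgebra.cstarAlgebra _ (h_closed := hcl)
  let _ : CommCStarAlgebra (tupleAlgebra x) := { mul_comm := tupleAlgebra_mul_comm hcomm hsa }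
  let F : C(WeakDual.characterSpace ℂ (tupleAlgebra x), ℂ) :=
    ⟨fun χ => ((√(χ v).re : ℝ) : ℂ), by
      refine Complex.continuous_ofReal.comp
        (Real.continuous_sqrt.comp (Complex.continuous_re.comp ?_))
      exact map_continuous (WeakDual.gelfandTransform ℂ (tupleAlgebra x) v)⟩
  obtain ⟨k, hk⟩ := (gelfandStarTransform (tupleAlgebra x)).surjective F
  have h : v = star k * k := by
    apply (gelfandStarTransform (tupleAlgebra x)).injective
    change gelfandStarTransform (tupleAlgebra x) v =
      gelfandStarTransform (tupleAlgebra x) (star k * k)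
    have hk' : gelfandStarTransform (tupleAlgebra x) k = F := hk
    rw [map_mul, map_star, hk']
    ext χ
    change χ v = star ((√(χ v).re : ℝ) : ℂ) * ((√(χ v).re : ℝ) : ℂ)
    have h1 := Complex.le_def.1 (hv χ)
    rw [Complex.star_def, Complex.conj_ofReal, ← Complex.ofReal_mul, Real.mul_self_sqrt h1.1]
    exact Complex.ext rfl h1.2.symm
  exact ⟨k, congrArg Subtype.val h⟩

/-- An affine minorant of `f` on the cube gives an affine minorant of `f(x)`: the Gelfand transform
of the difference is nonnegative. -/
theorem exists_star_mul_self_tupleCalculus_sub {I : Fin n → Set ℝ} {f : (Fin n → ℝ) → ℝ}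
    (hf : ContinuousOn f (Set.univ.pi I)) {x : Fin n → B} (hcomm : ∀ i j, Commute (x i) (x j))
    (hsa : ∀ i, IsSelfAdjoint (x i)) (hI : ∀ i, spectrum ℝ (x i) ⊆ I i) {c : Fin n → ℝ} {d : ℝ}
    (hle : ∀ q ∈ Set.univ.pi I, ∑ i, c i * q i + d ≤ f q) :
    ∃ k, tupleCalculus f x + ∑ i, (-c i : ℂ) • x i + (-d : ℂ) • 1 = star k * k := by
  obtain ⟨w, hw, hwx⟩ : ∃ w : tupleAlgebra x, IsTupleCalculus f x w ∧ (w : B) = tupleCalculus f x := by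
    have h := (existsUnique_isTupleCalculus I f hf x hcomm hsa hI).exists
    exact ⟨h.choose, h.choose_spec, by rw [tupleCalculus, dif_pos h]⟩
  obtain ⟨k, hk⟩ := exists_star_mul_self_of_forall_character_nonneg hcomm hsa
    (w + ∑ i, (-c i : ℂ) • (⟨x i, mem_tupleAlgebra x i⟩ : tupleAlgebra x) + (-d : ℂ) • 1)
    fun χ => by
      have h := fun i => character_apply_mem_spectrum hsa χ i
      have h1 := hle (fun i => (χ ⟨x i, mem_tupleAlgebra x i⟩).re) fun i _ => hI i (h i).2
      have h2 : χ (w + ∑ i, (-c i : ℂ) • (⟨x i, mem_tupleAlgebra x i⟩ : tupleAlgebra x) +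
          (-d : ℂ) • 1) = ((f (fun i => (χ ⟨x i, mem_tupleAlgebra x i⟩).re) -
            (∑ i, c i * (χ ⟨x i, mem_tupleAlgebra x i⟩).re + d) : ℝ) : ℂ) := by
        rw [map_add, map_add, map_sum, map_smul, map_one, hw χ]
        simp_rw [map_smul]
        push_cast
        simp_rw [fun i => (h i).1]
        simp only [smul_eq_mul, neg_mul, Finset.sum_neg_distrib]
        ring
      rw [h2]
      exact Complex.zero_le_real.2 (sub_nonneg.2 h1)
  refine ⟨k, ?_⟩
  rw [← hk, ← hwx]
  simp

end Positivity

/-! ### Affine functions of column integrals -/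

section ColumnIntegrals

variable {A : Type*} [NonUnitalCStarAlgebra A] [PartialOrder A] [StarOrderedRing A]
variable {S : Type*} [TopologicalSpace S] [LocallyCompactSpace S]
  [TopologicalSpace.MetrizableSpace S] [MeasurableSpace S] [BorelSpace S]
variable (φ : A →ₚ[ℂ] ℂ) (C : NonUnitalStarSubalgebra ℂ A) (e : C ≃⋆ₐ[ℂ] C₀(S, ℂ))
  (hC : (C : Set A) ⊆ functionalCentralizer φ)
variable {T : Type*} [MeasurableSpace T] {ν : Measure T} {κ : Type*} [Fintype κ]

theorem condExpectation_affine (y : κ → 𝓜(ℂ, A)) (c : κ → ℂ) (d : ℂ) :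
    condExpectation φ C e hC (∑ i, c i • y i + d • 1) =ᵐ[representingMeasure φ C e]
      fun s => ∑ i, c i * condExpectation φ C e hC (y i) s + d := by
  filter_upwards [condExpectation_add φ C e hC (∑ i, c i • y i) (d • 1),
    condExpectation_sum φ C e hC Finset.univ fun i => c i • y i,
    ae_all_iff.2 fun i => condExpectation_smul φ C e hC (c i) (y i),
    condExpectation_smul φ C e hC d 1, condExpectation_one φ C e hC] with s h1 h2 h3 h4 h5
  rw [h1, h2, h4, h5, mul_one]
  simp_rw [h3]

theorem ae_affine_nonneg {a : T → 𝓜(ℂ, A)}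
    (ha : IsWeakStarIntegral ν (fun t => star (a t) * a t) 1) {b : κ → T → 𝓜(ℂ, A)}
    {y : κ → 𝓜(ℂ, A)} (hy : ∀ i, IsWeakStarIntegral ν (fun t => star (a t) * b i t * a t) (y i))
    {c : κ → ℂ} {d : ℂ} (hpos : ∀ t, ∃ k, ∑ i, c i • b i t + d • 1 = star k * k) :
    ∀ᵐ s ∂(representingMeasure φ C e), 0 ≤ ∑ i, c i * condExpectation φ C e hC (y i) s + d := by
  filter_upwards [condExpectation_affine φ C e hC y c d,
    condExpectation_nonneg_of_isWeakStarIntegral φ C e hC (ha.affine hy c d) hpos] with s h1 h2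
  rwa [← h1]

theorem ae_le_condExpectation {a : T → 𝓜(ℂ, A)}
    (ha : IsWeakStarIntegral ν (fun t => star (a t) * a t) 1) {b : T → 𝓜(ℂ, A)} {y : 𝓜(ℂ, A)}
    (hy : IsWeakStarIntegral ν (fun t => star (a t) * b t * a t) y)
    (hb : ∀ t, IsSelfAdjoint (b t)) {α : ℝ} (hα : ∀ t, ∀ r ∈ spectrum ℝ (b t), α ≤ r) :
    ∀ᵐ s ∂(representingMeasure φ C e), (α : ℂ) ≤ condExpectation φ C e hC y s := by
  have h := ae_affine_nonneg φ C e hC (κ := Unit) ha (fun _ => hy) (c := fun _ => 1)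
    (d := -α) fun t => by simpa using (hb t).exists_star_mul_self_of_le_spectrum (hα t)
  filter_upwards [h] with s hs
  simpa [← sub_eq_add_neg] using hs

theorem ae_lt_condExpectation {a : T → 𝓜(ℂ, A)}
    (ha : IsWeakStarIntegral ν (fun t => star (a t) * a t) 1) {b : T → 𝓜(ℂ, A)} {y : 𝓜(ℂ, A)}
    (hy : IsWeakStarIntegral ν (fun t => star (a t) * b t * a t) y)
    (hb : ∀ t, IsSelfAdjoint (b t)) {α : ℝ} (hα : ∀ t, ∀ r ∈ spectrum ℝ (b t), α < r) :
    ∀ᵐ s ∂(representingMeasure φ C e), (α : ℂ) < condExpectation φ C e hC y s := by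
  have hint := ha.affine (κ := Unit) (fun _ => hy) (fun _ => 1) (-α)
  have h := condExpectation_pos_of_isWeakStarIntegral φ C e hC ha hint fun t => by
    simpa using (hb t).exists_star_mul_self_add_of_lt_spectrum (hα t)
  filter_upwards [h, condExpectation_affine φ C e hC (κ := Unit) (fun _ => y) (fun _ => 1) (-α)]
    with s h1 h2
  rw [h2] at h1
  simpa [← sub_eq_add_neg] using h1

/-- The infimum of `I` is a lower bound of `Φ(y)`, and a strict one if it does not belong to `I`. -/
theorem ae_exists_mem_le_condExpectation {a : T → 𝓜(ℂ, A)}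
    (ha : IsWeakStarIntegral ν (fun t => star (a t) * a t) 1) {b : T → 𝓜(ℂ, A)} {y : 𝓜(ℂ, A)}
    (hy : IsWeakStarIntegral ν (fun t => star (a t) * b t * a t) y)
    (hb : ∀ t, IsSelfAdjoint (b t)) {I : Set ℝ} (hI : ∀ t, spectrum ℝ (b t) ⊆ I) :
    ∀ᵐ s ∂(representingMeasure φ C e), ∃ r ∈ I, r ≤ (condExpectation φ C e hC y s).re := by
  rcases I.eq_empty_or_nonempty with rfl | hne
  · -- Every real number is a strict lower bound of the empty set.
    have h := fun N : ℕ => ae_lt_condExpectation φ C e hC ha hy hb (α := N)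
      fun t r hr => (hI t hr).elim
    filter_upwards [ae_all_iff.2 h] with s hs
    obtain ⟨N, hN⟩ := exists_nat_gt (condExpectation φ C e hC y s).re
    exact absurd (Complex.lt_def.1 (hs N)).1 hN.not_gt
  by_cases hbd : BddBelow I
  · by_cases hmem : sInf I ∈ I
    · filter_upwards [ae_le_condExpectation φ C e hC ha hy hb fun t r hr => csInf_le hbd (hI t hr)]
        with s hs
      exact ⟨_, hmem, (Complex.le_def.1 hs).1⟩
    · filter_upwards [ae_lt_condExpectation φ C e hC ha hy hb fun t r hr =>
        lt_of_le_of_ne (csInf_le hbd (hI t hr)) fun h => hmem (h ▸ hI t hr)] with s hs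
      obtain ⟨r, hr, hlt⟩ := exists_lt_of_csInf_lt hne (Complex.lt_def.1 hs).1
      exact ⟨r, hr, hlt.le⟩
  · refine ae_of_all _ fun s => ?_
    obtain ⟨r, hr, hlt⟩ := not_bddBelow_iff.1 hbd (condExpectation φ C e hC y s).re
    exact ⟨r, hr, hlt.le⟩

/-- The bound on `‖b t‖` makes `b t + M` positive, so that `Φ(y)` is real even when `I` is unbounded
on both sides. -/
theorem ae_exists_mem_eq_condExpectation {a : T → 𝓜(ℂ, A)}
    (ha : IsWeakStarIntegral ν (fun t => star (a t) * a t) 1) {b : T → 𝓜(ℂ, A)} {y : 𝓜(ℂ, A)}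
    (hy : IsWeakStarIntegral ν (fun t => star (a t) * b t * a t) y)
    (hb : ∀ t, IsSelfAdjoint (b t)) {M : ℝ} (hM : ∀ t, ‖b t‖ ≤ M) {I : Set ℝ}
    (hIc : I.OrdConnected) (hI : ∀ t, spectrum ℝ (b t) ⊆ I) :
    ∀ᵐ s ∂(representingMeasure φ C e), ∃ r ∈ I, condExpectation φ C e hC y s = (r : ℂ) := by
  have hreal := ae_affine_nonneg φ C e hC (κ := Unit) ha (fun _ => hy) (c := fun _ => 1)
    (d := M) fun t => by simpa using (hb t).exists_star_mul_self_add_of_norm_le (hM t)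
  -- The upper bound is the lower bound for `-b` and `-I`.
  have hneg : IsWeakStarIntegral ν (fun t => star (a t) * -b t * a t) ((-1 : ℂ) • y) := by
    convert hy.smul (-1) using 2 with t
    simp
  have hupper := ae_exists_mem_le_condExpectation φ C e hC ha hneg (fun t => (hb t).neg) (I := -I)
    fun t => by rw [← spectrum.neg_eq]; exact Set.neg_subset_neg.2 (hI t)
  filter_upwards [hreal, hupper, ae_exists_mem_le_condExpectation φ C e hC ha hy hb hI,
    condExpectation_smul φ C e hC (-1) y] with s h1 ⟨r, hr, hle⟩ ⟨r', hr', hle'⟩ h2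
  rw [h2] at hle
  refine ⟨_, hIc.out hr' hr ⟨hle', ?_⟩, Complex.ext rfl ?_⟩
  · simp only [neg_mul, one_mul, Complex.neg_re] at hle
    linarith
  · have := (Complex.le_def.1 h1).2
    simpa using this.symm

end ColumnIntegrals

/-! ### The inequality -/

theorem isSelfAdjoint_coe_multiplier {A : Type*} [NonUnitalCStarAlgebra A] {x : A}
    (hx : IsSelfAdjoint x) : IsSelfAdjoint (x : 𝓜(ℂ, A)) := by
  change star (DoubleCentralizer.coeHom (𝕜 := ℂ) x) = DoubleCentralizer.coeHom x
  rw [← map_star, hx.star_eq]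

theorem commute_coe_multiplier {A : Type*} [NonUnitalCStarAlgebra A] {x y : A}
    (h : Commute x y) : Commute (x : 𝓜(ℂ, A)) (y : 𝓜(ℂ, A)) :=
  h.map (DoubleCentralizer.coeHom (𝕜 := ℂ) (A := A))

theorem norm_coe_multiplier_le {A : Type*} [NonUnitalCStarAlgebra A] (x : A) :
    ‖(x : 𝓜(ℂ, A))‖ ≤ ‖x‖ :=
  NonUnitalStarAlgHom.norm_apply_le (DoubleCentralizer.coeHom (𝕜 := ℂ) (A := A)) x

theorem mainTheorem6
    {A : Type*} [NonUnitalCStarAlgebra A] [PartialOrder A] [StarOrderedRing A]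
    -- a positive functional and a separable abelian `C*`-subalgebra of its centralizer
    (φ : A →ₚ[ℂ] ℂ) (C : NonUnitalStarSubalgebra ℂ A)
    (hCclosed : IsClosed (C : Set A)) (hCsep : TopologicalSpace.IsSeparable (C : Set A))
    (hCcomm : ∀ y ∈ C, ∀ z ∈ C, y * z = z * y)
    (hC : (C : Set A) ⊆ functionalCentralizer φ)
    -- the identification `C = C₀(S)`
    {S : Type*} [TopologicalSpace S] [LocallyCompactSpace S] [TopologicalSpace.MetrizableSpace S]
    [MeasurableSpace S] [BorelSpace S] (e : C ≃⋆ₐ[ℂ] C₀(S, ℂ))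
    -- a continuous convex function on a cube
    (n : ℕ) (I : Fin n → Set ℝ) (hI : ∀ i, (I i).OrdConnected)
    (f : (Fin n → ℝ) → ℝ) (hfcont : ContinuousOn f (Set.univ.pi I))
    (hfconv : ConvexOn ℝ (Set.univ.pi I) f)
    -- a unital column field
    {T : Type*} [TopologicalSpace T] [LocallyCompactSpace T] [T2Space T]
    [MeasurableSpace T] [BorelSpace T] (ν : Measure T) [ν.Regular]
    (a : T → 𝓜(ℂ, A)) (ha : IsUnitalColumnField ν a)
    -- a bounded weak* measurable field of abelian tuples in the domain of `f`
    (x : T → Fin n → A) (hxbdd : ∃ M : ℝ, ∀ t i, ‖x t i‖ ≤ M)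
    (hxmeas : ∀ i, IsWeakStarMeasurable ν fun t => x t i)
    (hxcomm : ∀ t i j, Commute (x t i) (x t j))
    (hxsa : ∀ t i, IsSelfAdjoint (x t i))
    (hxdom : ∀ t i, spectrum ℝ (x t i : 𝓜(ℂ, A)) ⊆ I i)
    -- `y i = ∫ a_t* x_{it} a_t dν(t)` and `z = ∫ a_t* f(x_t) a_t dν(t)`
    (y : Fin n → 𝓜(ℂ, A))
    (hy : ∀ i, IsWeakStarIntegral ν (fun t => star (a t) * (x t i : 𝓜(ℂ, A)) * a t) (y i))
    (z : 𝓜(ℂ, A))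
    (hz : IsWeakStarIntegral ν
      (fun t => star (a t) * tupleCalculus f (fun i => (x t i : 𝓜(ℂ, A))) * a t) z) :
    -- almost everywhere `(Φ(y₁), …, Φ(yₙ))` is a point of the cube, and
    -- `f(Φ(y₁), …, Φ(yₙ)) ≤ Φ(z)`
    ∀ᵐ s ∂(representingMeasure φ C e), ∃ r ∈ Set.univ.pi I,
      (∀ i, condExpectation φ C e hC (y i) s = (r i : ℂ)) ∧
        ((f r : ℝ) : ℂ) ≤ condExpectation φ C e hC z s := by
  set X : T → Fin n → 𝓜(ℂ, A) := fun t i => (x t i : 𝓜(ℂ, A)) with hX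
  have hsa : ∀ t i, IsSelfAdjoint (X t i) := fun t i => isSelfAdjoint_coe_multiplier (hxsa t i)
  have hcomm : ∀ t i j, Commute (X t i) (X t j) := fun t i j => commute_coe_multiplier (hxcomm t i j)
  obtain ⟨M, hM⟩ := hxbdd
  have hcube := fun i => ae_exists_mem_eq_condExpectation φ C e hC ha.integral_eq_one (hy i)
    (fun t => hsa t i) (fun t => (norm_coe_multiplier_le (x t i)).trans (hM t i)) (hI i)
    (fun t => hxdom t i)
  obtain ⟨J, hJ, hJle, hJlt⟩ := hfconv.exists_countable_affine_le hfcont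
  have hl : ∀ (l : (Fin n → ℝ) →L[ℝ] ℝ) q, l q = ∑ i, l (Pi.single i 1) * q i := fun l q => by
    conv_lhs => rw [← Finset.univ_sum_single q, map_sum]
    refine Finset.sum_congr rfl fun i _ => ?_
    have : (Pi.single i (q i) : Fin n → ℝ) = q i • Pi.single i 1 := by
      rw [← Pi.single_smul, smul_eq_mul, mul_one]
    rw [this, map_smul, smul_eq_mul, mul_comm]
  have hminor : ∀ j ∈ J, ∀ᵐ s ∂(representingMeasure φ C e), 0 ≤ condExpectation φ C e hC z s +
      ∑ i, (-(j.1 (Pi.single i 1) : ℝ) : ℂ) * condExpectation φ C e hC (y i) s + (-j.2 : ℂ) := by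
    intro j hj
    -- `none` indexes `f(x)`, with coefficient `1`, and `some i` indexes `xᵢ`.
    have h := ae_affine_nonneg φ C e hC (κ := Option (Fin n)) ha.integral_eq_one
      (b := fun o t => o.elim (tupleCalculus f (X t)) (X t)) (y := fun o => o.elim z y)
      (c := fun o => o.elim 1 fun i => (-(j.1 (Pi.single i 1) : ℝ) : ℂ)) (d := -j.2)
      (fun o => by cases o with
        | none => exact hz
        | some i => exact hy i)
      (fun t => by
        simp only [Fintype.sum_option, Option.elim_none, Option.elim_some, one_smul]
        exact exists_star_mul_self_tupleCalculus_sub hfcont (hcomm t) (hsa t) (hxdom t)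
          fun q hq => by rw [← hl]; exact hJle j hj q hq)
    simpa only [Fintype.sum_option, Option.elim_none, Option.elim_some, one_mul] using h
  filter_upwards [ae_all_iff.2 hcube, (ae_ball_iff hJ).2 hminor] with s hs hsJ
  choose r hr hrs using hs
  refine ⟨r, fun i _ => hr i, hrs, ?_⟩
  have hJs : ∀ j ∈ J, ((j.1 r + j.2 : ℝ) : ℂ) ≤ condExpectation φ C e hC z s := fun j hj => by
    have h := hsJ j hj
    rw [← sub_nonneg, hl]
    convert h using 1
    simp_rw [hrs]
    push_cast
    simp only [neg_mul, Finset.sum_neg_distrib]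
    ring
  have hrD : r ∈ Set.univ.pi I := fun i _ => hr i
  -- Some minorant exists, so that `Φ(z)(s)` is real.
  obtain ⟨j₀, hj₀, -⟩ := hJlt r hrD (f r - 1) (by linarith)
  refine Complex.le_def.2 ⟨le_of_forall_lt fun v hv => ?_, (Complex.le_def.1 (hJs j₀ hj₀)).2⟩
  obtain ⟨j, hj, hlt⟩ := hJlt r hrD v hv
  exact hlt.trans_le (Complex.le_def.1 (hJs j hj)).1
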